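/- Let $\overset{\circ}{\mathfrak g}$ be a finite-dimensional simple complex Lie algebra with Cartan subalgebra $\overset{\circ}{\mathfrak h}$, a choice of simple roots, and a symmetric non-degenerate invariant bilinear form $\langle\cdot,\cdot\rangle$, and let $A$ be a finitely generated commutative associative unital $\mathbb C$-algebra. Let $\mathfrak L=(\overset{\circ}{\mathfrak g}\otimes\mathbb C[t,t^{-1}]\oplus\mathbb CK)\rtimes\mathrm{Vir}$, where $\mathrm{Vir}$ has basis $\{d_n, C: n\in\mathbb Z\}$, with brackets $$[x\otimes t^n,y\otimes t^m]=[x,y]\otimes t^{n+m}+m\,\delta_{m,-n}\langle x,y\rangle K,\qquad [d_n,x\otimes t^m]=m\,x\otimes t^{n+m},$$ $$[d_n,d_m]=(m-n)d_{n+m}+\delta_{m,-n}\tfrac{n^3-n}{12}C,\qquad K,\ C\ \text{central},$$ and let $\mathfrak L(A)=\mathfrak L\otimes A$ with $[X\otimes a,Y\otimes b]=[X,Y]\otimes ab$. Put $\bar{\mathfrak h}=\overset{\circ}{\mathfrak h}\oplus\mathbb CK\oplus\mathbb Cd_0\oplus\mathbb CC$, $\mathfrak L(A)^0=\bar{\mathfrak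 h}\otimes A$, and $\mathfrak L(A)^+=\mathfrak L^+\otimes A$, where $\mathfrak L^+$ is spanned by the positive root spaces $\overset{\circ}{\mathfrak g}_\alpha\otimes 1$, the spaces $\overset{\circ}{\mathfrak g}\otimes t^n$ with $n>0$, and the $d_n$ with $n>0$. For a linear map $\psi:\bar{\mathfrak h}\otimes A\to\mathbb C$ let $M(\psi)$ be the Verma module, i.e. the $\mathfrak L(A)$-module induced from the one-dimensional $(\mathfrak L(A)^+\oplus\mathfrak L(A)^0)$-module on which $\mathfrak L(A)^+$ acts by zero and $\mathfrak L(A)^0$ acts through $\psi$. Let $M'(\psi)$ be its maximal proper submodule and $V(\psi)=M(\psi)/M'(\psi)$ the irreducible highest weight module. An $\mathfrak L(A)$-module $V$ is called integrable if it is the direct sum of its weight spaces with respect to $\bar{\mathfrak h}=\bar{\mathfrak h}\otimes 1$, these weight spaces are finite-dimensional, and for every root $\alpha$ of $\overset{\circ}{\mathfrak g}$, $x\in\overset{\circ}{\mathfrak g}_\alpha$, $n\in\mathbb Z$ and $a\in A$ the element $(x\otimes t^n)\otimes a$ acts locally nilpotently on $V$. **Theorem.** If $V(\psi)$ is integrable,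 then there is an ideal $I$ of $A$ with $\dim_{\mathbb C}A/I<\infty$ such that $$\psi(d_0\otimes I)=0,\qquad \psi(C\otimes I)=0,\qquad \psi\big((\overset{\circ}{\mathfrak h}\oplus\mathbb CK)\otimes\sqrt I\big)=0,$$ where $\sqrt I$ is the radical of $I$. -/

import Mathlib

open scoped TensorProduct

noncomputable section

namespace LoopAffineVirasoro

/-! ### The Virasoro algebra -/

/-- The underlying space of the Virasoro algebra: the first component holds the coefficients of
the `d n`, the second one the coefficient of the central element `C`. -/
def Virasoro : Type := (ℤ →₀ ℂ) × ℂ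

namespace Virasoro

instance : AddCommGroup Virasoro := inferInstanceAs (AddCommGroup ((ℤ →₀ ℂ) × ℂ))

instance : Module ℂ Virasoro := inferInstanceAs (Module ℂ ((ℤ →₀ ℂ) × ℂ))

/-- The basis element `d n`. -/
def d (n : ℤ) : Virasoro := (Finsupp.single n 1, 0)

/-- The central element `C`. -/
def C : Virasoro := (0, 1)

/-- The projection of the Virasoro algebra on the span of the `d n` (along `C`). -/
def coeffs : Virasoro →ₗ[ℂ] (ℤ →₀ ℂ) := LinearMap.fst ℂ (ℤ →₀ ℂ) ℂ

/-- The value of the bracket on `d n` and `d m`: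
`(m - n) d (n + m) + δ_{m, -n} (n ^ 3 - n) / 12 C`. -/
def bracketBasis (n m : ℤ) : Virasoro :=
  ((m : ℂ) - n) • d (n + m) + (if m = -n then ((n : ℂ) ^ 3 - n) / 12 else 0) • C

/-- The bilinear extension of `bracketBasis`. -/
def bracketAux : (ℤ →₀ ℂ) →ₗ[ℂ] (ℤ →₀ ℂ) →ₗ[ℂ] Virasoro :=
  Finsupp.linearCombination ℂ fun n : ℤ ↦ Finsupp.linearCombination ℂ fun m : ℤ ↦ bracketBasis n m

instance : Bracket Virasoro Virasoro where
  bracket x y := bracketAux (coeffs x) (coeffs y)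

lemma bracket_def (x y : Virasoro) : ⁅x, y⁆ = bracketAux (coeffs x) (coeffs y) := rfl

@[simp] lemma coeffs_d (n : ℤ) : coeffs (d n) = Finsupp.single n 1 := rfl

@[simp] lemma coeffs_C : coeffs C = 0 := rfl

@[simp] lemma bracketAux_single (n m : ℤ) :
    bracketAux (Finsupp.single n 1) (Finsupp.single m 1) = bracketBasis n m := by
  simp [bracketAux]

lemma coeffs_bracketBasis (n m : ℤ) :
    coeffs (bracketBasis n m) = ((m : ℂ) - n) • Finsupp.single (n + m) 1 := by
  rw [bracketBasis, map_add, map_smul, map_smul, coeffs_C, coeffs_d, smul_zero, add_zero]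

lemma bracketBasis_swap (n m : ℤ) : bracketBasis n m + bracketBasis m n = 0 := by
  have h1 : ((m : ℂ) - n) • d (n + m) + ((n : ℂ) - m) • d (m + n) = 0 := by
    rw [add_comm m n, ← add_smul]; simp
  have h2 : (if m = -n then ((n : ℂ) ^ 3 - n) / 12 else 0)
      + (if n = -m then ((m : ℂ) ^ 3 - m) / 12 else 0) = 0 := by
    by_cases h : m = -n
    · subst h
      simp
      ring
    · have h' : n ≠ -m := by lia
      simp [h, h']
  calc bracketBasis n m + bracketBasis m n
      = (((m : ℂ) - n) • d (n + m) + ((n : ℂ) - m) • d (m + n))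
        + ((if m = -n then ((n : ℂ) ^ 3 - n) / 12 else 0)
          + (if n = -m then ((m : ℂ) ^ 3 - m) / 12 else 0)) • C := by
          rw [bracketBasis, bracketBasis, add_smul]; abel
    _ = 0 := by rw [h1, h2, zero_smul, add_zero]

lemma bracketAux_swap (f g : ℤ →₀ ℂ) : bracketAux f g + bracketAux g f = 0 := by
  have : bracketAux + bracketAux.flip = 0 := by
    ext n m : 4
    simpa using bracketBasis_swap n m
  simpa using LinearMap.congr_fun₂ this f g

lemma bracketAux_self (f : ℤ →₀ ℂ) : bracketAux f f = 0 := by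
  have h := bracketAux_swap f f
  rw [← two_smul ℂ] at h
  exact (smul_eq_zero.mp h).resolve_left two_ne_zero

lemma jacobi_basis (n m k : ℤ) :
    bracketAux (Finsupp.single n 1) (coeffs (bracketBasis m k)) =
      bracketAux (coeffs (bracketBasis n m)) (Finsupp.single k 1) +
      bracketAux (Finsupp.single m 1) (coeffs (bracketBasis n k)) := by
  simp only [coeffs_bracketBasis, map_smul, LinearMap.smul_apply, bracketAux_single]
  simp only [bracketBasis, smul_add, smul_smul]
  have e1 : n + m + k = n + (m + k) := by ring
  have e2 : m + (n + k) = n + (m + k) := by ring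
  rw [e1, e2]
  have h1 : ((k : ℂ) - m) * (((m + k : ℤ) : ℂ) - n) =
      ((m : ℂ) - n) * ((k : ℂ) - ((n + m : ℤ) : ℂ)) +
      ((k : ℂ) - n) * (((n + k : ℤ) : ℂ) - m) := by
    push_cast; ring
  have h2 : ((k : ℂ) - m) * (if m + k = -n then ((n : ℂ) ^ 3 - n) / 12 else 0) =
      ((m : ℂ) - n) * (if k = -(n + m) then (((n + m : ℤ) : ℂ) ^ 3 - ((n + m : ℤ) : ℂ)) / 12 else 0)
      + ((k : ℂ) - n) * (if n + k = -m then ((m : ℂ) ^ 3 - m) / 12 else 0) := by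
    by_cases h : k = -(n + m)
    · subst h
      rw [if_pos (by ring), if_pos rfl, if_pos (by ring)]
      push_cast
      ring
    · rw [if_neg (by lia), if_neg h, if_neg (by lia)]
      simp
  rw [h1, h2, add_smul, add_smul]
  abel

lemma jacobi_aux (f g h : ℤ →₀ ℂ) :
    bracketAux f (coeffs (bracketAux g h)) =
      bracketAux (coeffs (bracketAux f g)) h + bracketAux g (coeffs (bracketAux f h)) := by
  induction f using Finsupp.induction_linear with
  | zero => simp
  | add f₁ f₂ h₁ h₂ => simp only [map_add, LinearMap.add_apply, h₁, h₂]; abel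
  | single n a =>
    induction g using Finsupp.induction_linear with
    | zero => simp
    | add f₁ f₂ h₁ h₂ => simp only [map_add, LinearMap.add_apply, h₁, h₂]; abel
    | single m b =>
      induction h using Finsupp.induction_linear with
      | zero => simp
      | add f₁ f₂ h₁ h₂ => simp only [map_add, h₁, h₂]; abel
      | single k c =>
        rw [← mul_one a, ← mul_one b, ← mul_one c, ← smul_eq_mul, ← smul_eq_mul (a := b),
          ← smul_eq_mul (a := c), ← Finsupp.smul_single, ← Finsupp.smul_single,
          ← Finsupp.smul_single]
        simp only [map_smul, LinearMap.smul_apply, bracketAux_single]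
        rw [jacobi_basis]
        module

instance : LieRing Virasoro where
  add_lie x y z := by simp only [bracket_def, map_add, LinearMap.add_apply]
  lie_add x y z := by simp only [bracket_def, map_add]
  lie_self x := bracketAux_self _
  leibniz_lie x y z := jacobi_aux _ _ _

instance : LieAlgebra ℂ Virasoro where
  lie_smul t x y := by simp only [bracket_def, map_smul]

lemma lie_d_d (n m : ℤ) :
    ⁅d n, d m⁆ =
      ((m : ℂ) - n) • d (n + m) + (if m = -n then ((n : ℂ) ^ 3 - n) / 12 else 0) • C := by
  rw [bracket_def, coeffs_d, coeffs_d, bracketAux_single, bracketBasis]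

lemma lie_C (x : Virasoro) : ⁅C, x⁆ = 0 := by simp [bracket_def]

end Virasoro

/-! ### The affine algebra and its semidirect product with the Virasoro algebra -/

/-- A symmetric, non-degenerate, invariant bilinear form on a complex Lie algebra. -/
structure InvariantForm (𝔤 : Type*) [LieRing 𝔤] [LieAlgebra ℂ 𝔤] where
  form : LinearMap.BilinForm ℂ 𝔤
  symm : form.IsSymm
  invariant : form.lieInvariant 𝔤
  nondegenerate : form.Nondegenerate

section Affine

variable {𝔤 : Type*} [LieRing 𝔤] [LieAlgebra ℂ 𝔤]

/-- The element `x ⊗ t ^ n` of the loop algebra of `𝔤`. -/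
def loopElt (x : 𝔤) (n : ℤ) : LieAlgebra.loopAlgebra ℂ ℤ 𝔤 :=
  AddMonoidAlgebra.single n 1 ⊗ₜ[ℂ] x

lemma loop_induction {p : LieAlgebra.loopAlgebra ℂ ℤ 𝔤 → Prop} (l : LieAlgebra.loopAlgebra ℂ ℤ 𝔤)
    (zero : p 0) (add : ∀ l l', p l → p l' → p (l + l')) (elt : ∀ x n, p (loopElt x n)) : p l := by
  induction l using TensorProduct.induction_on with
  | zero => exact zero
  | add l l' h h' => exact add l l' h h'
  | tmul f x =>
    induction f using AddMonoidAlgebra.induction_linear with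
    | zero => rwa [TensorProduct.zero_tmul]
    | add f g hf hg => rw [TensorProduct.add_tmul]; exact add _ _ hf hg
    | single n r =>
      have : AddMonoidAlgebra.single n r ⊗ₜ[ℂ] x = loopElt (r • x) n := by
        rw [loopElt, ← TensorProduct.smul_tmul, AddMonoidAlgebra.smul_single, smul_eq_mul, mul_one]
      rw [this]
      exact elt _ _

lemma loop_add_lie (l l' k : LieAlgebra.loopAlgebra ℂ ℤ 𝔤) : ⁅l + l', k⁆ = ⁅l, k⁆ + ⁅l', k⁆ :=
  LieRing.add_lie _ _ _

lemma loop_lie_add (l l' k : LieAlgebra.loopAlgebra ℂ ℤ 𝔤) : ⁅k, l + l'⁆ = ⁅k, l⁆ + ⁅k, l'⁆ :=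
  LieRing.lie_add _ _ _

lemma loop_zero_lie (k : LieAlgebra.loopAlgebra ℂ ℤ 𝔤) :
    ⁅(0 : LieAlgebra.loopAlgebra ℂ ℤ 𝔤), k⁆ = 0 := zero_lie k

lemma loop_lie_zero (k : LieAlgebra.loopAlgebra ℂ ℤ 𝔤) :
    ⁅k, (0 : LieAlgebra.loopAlgebra ℂ ℤ 𝔤)⁆ = 0 := lie_zero k

lemma loop_lie_smul (a : ℂ) (l k : LieAlgebra.loopAlgebra ℂ ℤ 𝔤) : ⁅l, a • k⁆ = a • ⁅l, k⁆ :=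
  LieAlgebra.lie_smul a l k

lemma lie_loopElt (x y : 𝔤) (n m : ℤ) :
    ⁅loopElt x n, loopElt y m⁆ = loopElt ⁅x, y⁆ (n + m) := by
  rw [loopElt, loopElt, LieAlgebra.ExtendScalars.bracket_tmul, AddMonoidAlgebra.single_mul_single,
    mul_one, loopElt]

variable (B : InvariantForm 𝔤)

lemma residue_loopElt (x y : 𝔤) (n m : ℤ) :
    LieAlgebra.LoopAlgebra.residuePairing ℂ ℤ 𝔤 B.form (loopElt x n) (loopElt y m) =
      if m = -n then (m : ℂ) * B.form x y else 0 := by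
  have e (z : 𝔤) (k : ℤ) : LieAlgebra.LoopAlgebra.toFinsupp ℂ ℤ 𝔤 (loopElt z k) =
      Finsupp.single k z := LieAlgebra.LoopAlgebra.toFinsupp_single_tmul ℂ ℤ 𝔤 k z
  rw [LieAlgebra.LoopAlgebra.residuePairing_apply_apply, e, e, Finsupp.sum_single_index (by simp)]
  by_cases h : m = -n
  · subst h
    simp
  · have : n ≠ -m := by lia
    simp [h, this]

/-- The derived affine Lie algebra `𝔤 ⊗ ℂ[t, t⁻¹] ⊕ ℂ K`, as the central extension of the loop
algebra by the cocycle `(x ⊗ t ^ n, y ⊗ t ^ m) ↦ m δ_{m, -n} ⟨x, y⟩`. -/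
def AffineAlgebra : Type _ :=
  LieAlgebra.ofTwoCocycle
    (LieAlgebra.LoopAlgebra.twoCocycleOfBilinear ℂ ℤ 𝔤 B.form B.invariant B.symm)

namespace AffineAlgebra

instance : LieRing (AffineAlgebra B) := inferInstanceAs (LieRing (LieAlgebra.ofTwoCocycle
    (LieAlgebra.LoopAlgebra.twoCocycleOfBilinear ℂ ℤ 𝔤 B.form B.invariant B.symm)))

instance : LieAlgebra ℂ (AffineAlgebra B) := inferInstanceAs (LieAlgebra ℂ (LieAlgebra.ofTwoCocycle
    (LieAlgebra.LoopAlgebra.twoCocycleOfBilinear ℂ ℤ 𝔤 B.form B.invariant B.symm)))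

/-- The element `l + k K`, for `l` in the loop algebra and `k` a scalar. -/
def mk (l : LieAlgebra.loopAlgebra ℂ ℤ 𝔤) (k : ℂ) : AffineAlgebra B :=
  LieAlgebra.ofProd _ (l, (TrivialLieModule.equiv ℂ (LieAlgebra.loopAlgebra ℂ ℤ 𝔤) ℂ).symm k)

/-- The projection on the loop algebra along `K`. -/
def loopPart : AffineAlgebra B →ₗ[ℂ] LieAlgebra.loopAlgebra ℂ ℤ 𝔤 where
  toFun x := ((LieAlgebra.ofProd _).symm x).1
  map_add' _ _ := rfl
  map_smul' _ _ := rfl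

@[simp] lemma loopPart_mk (l : LieAlgebra.loopAlgebra ℂ ℤ 𝔤) (k : ℂ) :
    loopPart B (mk B l k) = l := rfl

lemma mk_surjective (x : AffineAlgebra B) : ∃ l k, x = mk B l k := ⟨_, x.carrier.2, rfl⟩

lemma mk_add (l l' : LieAlgebra.loopAlgebra ℂ ℤ 𝔤) (k k' : ℂ) :
    mk B l k + mk B l' k' = mk B (l + l') (k + k') := rfl

lemma mk_smul (l : LieAlgebra.loopAlgebra ℂ ℤ 𝔤) (r k : ℂ) :
    r • mk B l k = mk B (r • l) (r * k) := rfl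

lemma mk_sub (l l' : LieAlgebra.loopAlgebra ℂ ℤ 𝔤) (k k' : ℂ) :
    mk B l k - mk B l' k' = mk B (l - l') (k - k') := by
  rw [sub_eq_iff_eq_add, mk_add, sub_add_cancel, sub_add_cancel]

lemma lie_mk (l l' : LieAlgebra.loopAlgebra ℂ ℤ 𝔤) (k k' : ℂ) :
    ⁅mk B l k, mk B l' k'⁆ =
      mk B ⁅l, l'⁆ (LieAlgebra.LoopAlgebra.residuePairing ℂ ℤ 𝔤 B.form l l') := by
  refine congrArg (LieAlgebra.ofProd _) (Prod.ext rfl ?_)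
  refine (add_sub_assoc _ _ _).trans ?_
  refine (congrArg₂ (fun a b : ℂ ↦ LieAlgebra.LoopAlgebra.residuePairing ℂ ℤ 𝔤 B.form l l' + (a - b))
    (rfl : _ = (0 : ℂ)) (rfl : _ = (0 : ℂ))).trans ?_
  rw [sub_zero, add_zero]
  rfl

/-- The element `x ⊗ t ^ n`. -/
def elt (x : 𝔤) (n : ℤ) : AffineAlgebra B := mk B (loopElt x n) 0

/-- The central element `K`. -/
def K : AffineAlgebra B := mk B 0 1

lemma lie_elt_elt (x y : 𝔤) (n m : ℤ) :
    ⁅elt B x n, elt B y m⁆ =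
      elt B ⁅x, y⁆ (n + m) + (if m = -n then (m : ℂ) * B.form x y else 0) • K B := by
  rw [elt, elt, elt, K, lie_mk, mk_smul, mk_add, lie_loopElt, residue_loopElt, smul_zero, add_zero,
    zero_add, mul_one]

lemma lie_K (x : AffineAlgebra B) : ⁅K B, x⁆ = 0 := by
  obtain ⟨l, k, rfl⟩ := mk_surjective B x
  rw [K, lie_mk, map_zero, LinearMap.zero_apply, loop_zero_lie]
  rfl

end AffineAlgebra

/-- The derivation `t ^ n (t d/dt)` of the Laurent polynomials, as a linear map:
it sends `t ^ m` to `m t ^ (m + n)`. -/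
def laurentDer (n : ℤ) : AddMonoidAlgebra ℂ ℤ →ₗ[ℂ] AddMonoidAlgebra ℂ ℤ :=
  (AddMonoidAlgebra.basis ℤ ℂ).constr ℂ fun m : ℤ ↦ AddMonoidAlgebra.single (m + n) (m : ℂ)

lemma laurentDer_single (n m : ℤ) :
    laurentDer n (AddMonoidAlgebra.single m 1) = AddMonoidAlgebra.single (m + n) (m : ℂ) := by
  rw [← AddMonoidAlgebra.basis_apply, laurentDer, Module.Basis.constr_basis]

/-- The action of the Virasoro algebra on the loop algebra, `d n · (x ⊗ t ^ m) = m x ⊗ t ^ (m + n)`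
and `C` acts by zero. -/
def loopAction : Virasoro →ₗ[ℂ] Module.End ℂ (LieAlgebra.loopAlgebra ℂ ℤ 𝔤) :=
  (Finsupp.linearCombination ℂ fun n : ℤ ↦ (laurentDer n).rTensor 𝔤) ∘ₗ Virasoro.coeffs

lemma loopAction_d (n m : ℤ) (x : 𝔤) :
    loopAction (Virasoro.d n) (loopElt x m) = (m : ℂ) • loopElt x (m + n) := by
  simp only [loopAction, LinearMap.comp_apply, Virasoro.coeffs_d,
    Finsupp.linearCombination_single, one_smul, loopElt, LinearMap.rTensor_tmul,
    laurentDer_single]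
  rw [TensorProduct.smul_tmul', AddMonoidAlgebra.smul_single, smul_eq_mul, mul_one]

lemma loopAction_C (l : LieAlgebra.loopAlgebra ℂ ℤ 𝔤) :
    loopAction Virasoro.C l = 0 := by
  simp [loopAction]

lemma virasoro_induction {p : Virasoro → Prop} (v : Virasoro)
    (add : ∀ v w, p v → p w → p (v + w)) (d : ∀ (a : ℂ) n, p (a • Virasoro.d n))
    (C : ∀ a : ℂ, p (a • Virasoro.C)) : p v := by
  have hv : v = LinearMap.inl ℂ (ℤ →₀ ℂ) ℂ v.1 + LinearMap.inr ℂ (ℤ →₀ ℂ) ℂ v.2 :=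
    Prod.ext (add_zero _).symm (zero_add _).symm
  have hC (a : ℂ) : LinearMap.inr ℂ (ℤ →₀ ℂ) ℂ a = a • Virasoro.C :=
    Prod.ext (smul_zero _).symm (mul_one a).symm
  have hd (a : ℂ) (n : ℤ) :
      LinearMap.inl ℂ (ℤ →₀ ℂ) ℂ (Finsupp.single n a) = a • Virasoro.d n :=
    Prod.ext (by change _ = a • Finsupp.single n 1; simp) (mul_zero _).symm
  have h0 : p 0 := by simpa using C 0
  rw [hv, hC]
  refine add _ _ ?_ (C _)
  generalize v.1 = f
  induction f using Finsupp.induction_linear with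
  | zero => rw [map_zero]; exact h0
  | add f g hf hg => rw [map_add]; exact add _ _ hf hg
  | single n a => rw [hd]; exact d _ _

lemma loopAction_lie (v w : Virasoro) (l : LieAlgebra.loopAlgebra ℂ ℤ 𝔤) :
    loopAction ⁅v, w⁆ l = loopAction v (loopAction w l) - loopAction w (loopAction v l) := by
  induction v using virasoro_induction with
  | add v v' h h' => simp only [add_lie, map_add, LinearMap.add_apply, h, h']; abel
  | C a => simp [smul_lie, Virasoro.lie_C, loopAction_C]
  | d a n =>
    induction w using virasoro_induction with
    | add v v' h h' => simp only [lie_add, map_add, LinearMap.add_apply, h, h']; abel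
    | C b =>
      rw [lie_smul, ← lie_skew, Virasoro.lie_C]
      simp [loopAction_C]
    | d b m =>
      induction l using loop_induction with
      | zero => simp
      | add l l' h h' => simp only [map_add, h, h']; abel
      | elt x k =>
        simp only [smul_lie, lie_smul, Virasoro.lie_d_d, map_smul, map_add, LinearMap.add_apply,
          LinearMap.smul_apply, loopAction_d, loopAction_C, smul_zero, add_zero]
        rw [show k + m + n = k + (n + m) by ring, show k + n + m = k + (n + m) by ring]
        push_cast
        module

lemma loopAction_leibniz (v : Virasoro) (l l' : LieAlgebra.loopAlgebra ℂ ℤ 𝔤) :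
    loopAction v ⁅l, l'⁆ = ⁅l, loopAction v l'⁆ - ⁅l', loopAction v l⁆ := by
  induction v using virasoro_induction with
  | add v v' h h' => simp only [map_add, LinearMap.add_apply, h, h', loop_lie_add]; abel
  | C a => simp [loopAction_C, loop_lie_zero]
  | d a n =>
    induction l using loop_induction with
    | zero => simp [loop_lie_zero, loop_zero_lie]
    | add l₁ l₂ h h' => simp only [map_add, loop_add_lie, loop_lie_add, h, h']; abel
    | elt x k =>
      induction l' using loop_induction with
      | zero => simp [loop_lie_zero, loop_zero_lie]
      | add l₁ l₂ h h' => simp only [map_add, loop_add_lie, loop_lie_add, h, h']; abel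
      | elt y m =>
        simp only [map_smul, LinearMap.smul_apply, loopAction_d, loop_lie_smul, lie_loopElt]
        rw [show m + (k + n) = k + m + n by ring, show k + (m + n) = k + m + n by ring,
          ← lie_skew y x, show loopElt (-⁅x, y⁆) (k + m + n) = -loopElt ⁅x, y⁆ (k + m + n) from
            TensorProduct.tmul_neg _ _]
        push_cast
        module

lemma residue_loopAction (v : Virasoro) (l l' : LieAlgebra.loopAlgebra ℂ ℤ 𝔤) :
    LieAlgebra.LoopAlgebra.residuePairing ℂ ℤ 𝔤 B.form l (loopAction v l') =
      LieAlgebra.LoopAlgebra.residuePairing ℂ ℤ 𝔤 B.form l' (loopAction v l) := by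
  induction v using virasoro_induction with
  | add v v' h h' => simp only [map_add, LinearMap.add_apply, h, h']
  | C a => simp [loopAction_C]
  | d a n =>
    induction l using loop_induction with
    | zero => simp
    | add l₁ l₂ h h' => simp only [map_add, LinearMap.add_apply, h, h']
    | elt x k =>
      induction l' using loop_induction with
      | zero => simp
      | add l₁ l₂ h h' => simp only [map_add, LinearMap.add_apply, h, h']
      | elt y m =>
        simp only [map_smul, LinearMap.smul_apply, loopAction_d, residue_loopElt]
        by_cases h : m + n = -k
        · rw [if_pos h, if_pos (by lia), B.symm.eq x y]
          have : n = -k - m := by lia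
          subst this
          push_cast
          simp only [smul_eq_mul]
          ring
        · rw [if_neg h, if_neg (by lia)]
          simp

/-- The derivation of the derived affine algebra given by an element of the Virasoro algebra. -/
def virDerivation (v : Virasoro) : LieDerivation ℂ (AffineAlgebra B) (AffineAlgebra B) where
  toFun x := AffineAlgebra.mk B (loopAction v (AffineAlgebra.loopPart B x)) 0
  map_add' x y := by rw [map_add, map_add, AffineAlgebra.mk_add, add_zero]
  map_smul' r x := by
    rw [map_smul, map_smul, RingHom.id_apply, AffineAlgebra.mk_smul, mul_zero]
  leibniz' x y := by
    obtain ⟨l, k, rfl⟩ := AffineAlgebra.mk_surjective B x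
    obtain ⟨l', k', rfl⟩ := AffineAlgebra.mk_surjective B y
    change AffineAlgebra.mk B _ _ =
      ⁅_, AffineAlgebra.mk B _ _⁆ - ⁅_, AffineAlgebra.mk B _ _⁆
    simp only [AffineAlgebra.lie_mk, AffineAlgebra.loopPart_mk, AffineAlgebra.mk_sub]
    rw [loopAction_leibniz, residue_loopAction, sub_self]

lemma virDerivation_mk (v : Virasoro) (l : LieAlgebra.loopAlgebra ℂ ℤ 𝔤) (k : ℂ) :
    virDerivation B v (AffineAlgebra.mk B l k) = AffineAlgebra.mk B (loopAction v l) 0 := rfl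

/-- The action of the Virasoro algebra on the derived affine algebra by derivations:
`d n · (x ⊗ t ^ m) = m x ⊗ t ^ (m + n)`, `d n · K = 0`, and `C` acts by zero. -/
def virAction :
    Virasoro →ₗ⁅ℂ⁆ LieDerivation ℂ (AffineAlgebra B) (AffineAlgebra B) where
  toFun v := virDerivation B v
  map_add' v w := by
    ext x
    obtain ⟨l, k, rfl⟩ := AffineAlgebra.mk_surjective B x
    rw [LieDerivation.add_apply]
    simp only [virDerivation_mk, AffineAlgebra.mk_add, map_add, LinearMap.add_apply, add_zero]
  map_smul' r v := by
    ext x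
    obtain ⟨l, k, rfl⟩ := AffineAlgebra.mk_surjective B x
    rw [LieDerivation.smul_apply]
    simp only [virDerivation_mk, AffineAlgebra.mk_smul, map_smul, LinearMap.smul_apply, mul_zero,
      RingHom.id_apply]
  map_lie' {v w} := by
    ext x
    obtain ⟨l, k, rfl⟩ := AffineAlgebra.mk_surjective B x
    rw [LieDerivation.lie_apply]
    simp only [virDerivation_mk, AffineAlgebra.mk_sub, loopAction_lie, sub_self]

lemma virAction_mk (v : Virasoro) (l : LieAlgebra.loopAlgebra ℂ ℤ 𝔤) (k : ℂ) :
    virAction B v (AffineAlgebra.mk B l k) = AffineAlgebra.mk B (loopAction v l) 0 := rfl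

/-- The affine-Virasoro algebra `𝔏 = (𝔤 ⊗ ℂ[t, t⁻¹] ⊕ ℂ K) ⋊ Vir`. -/
def AffineVirasoro : Type _ := LieAlgebra.SemiDirectSum (AffineAlgebra B) Virasoro (virAction B)

namespace AffineVirasoro

instance : LieRing (AffineVirasoro B) :=
  inferInstanceAs (LieRing (LieAlgebra.SemiDirectSum (AffineAlgebra B) Virasoro (virAction B)))

instance : LieAlgebra ℂ (AffineVirasoro B) :=
  inferInstanceAs (LieAlgebra ℂ (LieAlgebra.SemiDirectSum (AffineAlgebra B) Virasoro (virAction B)))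

/-- The inclusion of the derived affine algebra. -/
def ofAffine : AffineAlgebra B →ₗ⁅ℂ⁆ AffineVirasoro B := LieAlgebra.SemiDirectSum.inl (virAction B)

/-- The inclusion of the Virasoro algebra. -/
def ofVir : Virasoro →ₗ⁅ℂ⁆ AffineVirasoro B := LieAlgebra.SemiDirectSum.inr (virAction B)

/-- The element `x ⊗ t ^ n`, as a linear function of `x`. -/
def elt (n : ℤ) : 𝔤 →ₗ[ℂ] AffineVirasoro B where
  toFun x := ofAffine B (AffineAlgebra.elt B x n)
  map_add' x y := by
    rw [← map_add, AffineAlgebra.elt, AffineAlgebra.elt, AffineAlgebra.elt, AffineAlgebra.mk_add,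
      add_zero, loopElt, loopElt, loopElt, TensorProduct.tmul_add]
  map_smul' r x := by
    rw [RingHom.id_apply, ← map_smul, AffineAlgebra.elt, AffineAlgebra.elt, AffineAlgebra.mk_smul,
      mul_zero, loopElt, loopElt, TensorProduct.tmul_smul]

/-- The affine central element `K`. -/
def K : AffineVirasoro B := ofAffine B (AffineAlgebra.K B)

/-- The element `d n` of the Virasoro algebra. -/
def d (n : ℤ) : AffineVirasoro B := ofVir B (Virasoro.d n)

/-- The Virasoro central element `C`. -/
def C : AffineVirasoro B := ofVir B Virasoro.C

lemma lie_elt_elt (x y : 𝔤) (n m : ℤ) :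
    ⁅elt B n x, elt B m y⁆ =
      elt B (n + m) ⁅x, y⁆ + (if m = -n then (m : ℂ) * B.form x y else 0) • K B := by
  change ⁅ofAffine B _, ofAffine B _⁆ = ofAffine B _ + _ • ofAffine B _
  rw [← LieHom.map_lie, AffineAlgebra.lie_elt_elt, map_add, map_smul]

lemma lie_d_d (n m : ℤ) :
    ⁅d B n, d B m⁆ =
      ((m : ℂ) - n) • d B (n + m) + (if m = -n then ((n : ℂ) ^ 3 - n) / 12 else 0) • C B := by
  rw [d, d, d, C, ← LieHom.map_lie, Virasoro.lie_d_d, map_add, map_smul, map_smul]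

lemma lie_ofVir_ofAffine (v : Virasoro) (x : AffineAlgebra B) :
    ⁅ofVir B v, ofAffine B x⁆ = ofAffine B (virAction B v x) := by
  refine LieAlgebra.SemiDirectSum.ext ?_ ?_
  · change ⁅(0 : AffineAlgebra B), x⁆ + virAction B v x - virAction B 0 0 = _
    rw [zero_lie, map_zero, sub_zero, zero_add]
    rfl
  · exact lie_zero v

lemma lie_d_elt (n m : ℤ) (x : 𝔤) : ⁅d B n, elt B m x⁆ = (m : ℂ) • elt B (m + n) x := by
  change ⁅ofVir B _, ofAffine B _⁆ = _ • ofAffine B _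
  rw [lie_ofVir_ofAffine, AffineAlgebra.elt, virAction_mk, loopAction_d, ← map_smul,
    AffineAlgebra.elt, AffineAlgebra.mk_smul, mul_zero]

lemma exists_eq (x : AffineVirasoro B) : ∃ y v, x = ofAffine B y + ofVir B v :=
  ⟨x.left, x.right, LieAlgebra.SemiDirectSum.ext (add_zero _).symm (zero_add _).symm⟩

lemma lie_K (x : AffineVirasoro B) : ⁅K B, x⁆ = 0 := by
  obtain ⟨y, v, rfl⟩ := exists_eq B x
  rw [lie_add, K, ← LieHom.map_lie, AffineAlgebra.lie_K, map_zero, zero_add, ← lie_skew,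
    lie_ofVir_ofAffine, AffineAlgebra.K, virAction_mk, map_zero, neg_eq_zero]
  exact map_zero (ofAffine B)

lemma lie_C (x : AffineVirasoro B) : ⁅C B, x⁆ = 0 := by
  obtain ⟨y, v, rfl⟩ := exists_eq B x
  obtain ⟨l, k, rfl⟩ := AffineAlgebra.mk_surjective B y
  rw [lie_add, C, ← LieHom.map_lie, Virasoro.lie_C, map_zero, add_zero, lie_ofVir_ofAffine,
    virAction_mk, loopAction_C]
  exact map_zero (ofAffine B)

end AffineVirasoro

end Affine

/-! ### The loop affine-Virasoro algebra -/

section Loop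

variable {𝔤 : Type*} [LieRing 𝔤] [LieAlgebra ℂ 𝔤]
variable (A : Type*) [CommRing A] [Algebra ℂ A] (B : InvariantForm 𝔤)

/-- The loop affine-Virasoro algebra `𝔏(A) = 𝔏 ⊗ A`, with bracket
`[X ⊗ a, Y ⊗ b] = [X, Y] ⊗ ab`. -/
def LoopAlgebra : Type _ := A ⊗[ℂ] AffineVirasoro B

namespace LoopAlgebra

instance : LieRing (LoopAlgebra A B) := inferInstanceAs (LieRing (A ⊗[ℂ] AffineVirasoro B))

instance : LieAlgebra ℂ (LoopAlgebra A B) :=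
  inferInstanceAs (LieAlgebra ℂ (A ⊗[ℂ] AffineVirasoro B))

/-- The identification of `𝔏(A)` with the tensor product, as a linear map. -/
def ofTensor : A ⊗[ℂ] AffineVirasoro B →ₗ[ℂ] LoopAlgebra A B where
  toFun x := x
  map_add' _ _ := rfl
  map_smul' _ _ := rfl

variable {A}

/-- The element `X ⊗ a` of `𝔏(A)`. -/
def elt (a : A) (X : AffineVirasoro B) : LoopAlgebra A B := ofTensor A B (a ⊗ₜ[ℂ] X)

lemma lie_elt_elt (a b : A) (X Y : AffineVirasoro B) :
    ⁅elt B a X, elt B b Y⁆ = elt B (a * b) ⁅X, Y⁆ := rfl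

end LoopAlgebra

variable (H : LieSubalgebra ℂ 𝔤)

/-- The Cartan subalgebra `𝔥 ⊕ ℂ K ⊕ ℂ d 0 ⊕ ℂ C` of `𝔏(A)` (as a subspace of `𝔏`). -/
def cartan : Submodule ℂ (AffineVirasoro B) :=
  H.toSubmodule.map (AffineVirasoro.elt B 0) ⊔
    Submodule.span ℂ {AffineVirasoro.K B, AffineVirasoro.d B 0, AffineVirasoro.C B}

namespace cartan

/-- The element `h ⊗ 1` of the Cartan subalgebra, for `h` in the finite Cartan subalgebra. -/
def ofFinite (h : H) : cartan B H :=
  ⟨AffineVirasoro.elt B 0 h, Submodule.mem_sup_left (Submodule.mem_map_of_mem h.2)⟩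

/-- The element `K` of the Cartan subalgebra. -/
def K : cartan B H :=
  ⟨AffineVirasoro.K B, Submodule.mem_sup_right (Submodule.subset_span (by simp))⟩

/-- The element `d 0` of the Cartan subalgebra. -/
def d₀ : cartan B H :=
  ⟨AffineVirasoro.d B 0, Submodule.mem_sup_right (Submodule.subset_span (by simp))⟩

/-- The element `C` of the Cartan subalgebra. -/
def C : cartan B H :=
  ⟨AffineVirasoro.C B, Submodule.mem_sup_right (Submodule.subset_span (by simp))⟩

end cartan

/-- The inclusion of `𝔏(A)⁰ = A ⊗ cartan` in `𝔏(A)`. -/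
def cartanIncl : A ⊗[ℂ] cartan B H →ₗ[ℂ] LoopAlgebra A B :=
  LoopAlgebra.ofTensor A B ∘ₗ (cartan B H).subtype.lTensor A

section Integrable

variable (V : Type*) [AddCommGroup V] [Module ℂ V] [LieRingModule (LoopAlgebra A B) V]
  [LieModule ℂ (LoopAlgebra A B) V]

/-- The weight space `{v | h v = wt h • v for all h in the Cartan subalgebra}`,
where `h` acts as `h ⊗ 1`. -/
def weightSpace (wt : Module.Dual ℂ (cartan B H)) : Submodule ℂ V :=
  ⨅ h : cartan B H,
    (LieModule.toEnd ℂ (LoopAlgebra A B) V (LoopAlgebra.elt B 1 (h : AffineVirasoro B))).eigenspace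
      (wt h)

lemma mem_weightSpace (wt : Module.Dual ℂ (cartan B H)) (v : V) :
    v ∈ weightSpace A B H V wt ↔
      ∀ h : cartan B H, ⁅LoopAlgebra.elt B (1 : A) (h : AffineVirasoro B), v⁆ = wt h • v := by
  simp [weightSpace]

open Classical in
/-- `V` is an integrable `𝔏(A)`-module: it is the direct sum of its weight spaces, these are
finite-dimensional, and every `x ⊗ a`, with `x` in the root space `𝔤_α ⊗ t ^ n` of a real root
`α + n δ`, acts locally nilpotently. -/
structure IsIntegrable [LieRing.IsNilpotent H] : Prop where
  isInternal : DirectSum.IsInternal fun wt : Module.Dual ℂ (cartan B H) ↦ weightSpace A B H V wt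
  finite_weightSpace : ∀ wt : Module.Dual ℂ (cartan B H), Module.Finite ℂ (weightSpace A B H V wt)
  locally_nilpotent : ∀ (α : LieModule.Weight ℂ H 𝔤), α.IsNonZero →
    ∀ (n : ℤ), ∀ x ∈ LieAlgebra.rootSpace H α, ∀ (a : A) (v : V), ∃ N : ℕ,
      (LieModule.toEnd ℂ (LoopAlgebra A B) V
        (LoopAlgebra.elt B a (AffineVirasoro.elt B n x)) ^ N) v = 0

end Integrable

variable {H} [FiniteDimensional ℂ 𝔤] [LieAlgebra.IsKilling ℂ 𝔤] [H.IsCartanSubalgebra]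
variable (b : (LieAlgebra.IsKilling.rootSystem H).Base)

/-- The subspace `𝔫₊ ⊕ Vir⁺` of `𝔏`: it is spanned by the `x ⊗ 1` with `x` in the root space of a
positive root of `𝔤`, the `x ⊗ t ^ n` with `n > 0` and `x` in `𝔤`, and the `d n` with `n > 0`. -/
def positivePart : Submodule ℂ (AffineVirasoro B) :=
  Submodule.span ℂ
    ({X | ∃ α : H.root, b.IsPos α ∧ ∃ x ∈ LieAlgebra.rootSpace H α.1,
        X = AffineVirasoro.elt B 0 x} ∪
      {X | ∃ n : ℤ, 0 < n ∧ ∃ x : 𝔤, X = AffineVirasoro.elt B n x} ∪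
      {X | ∃ n : ℤ, 0 < n ∧ X = AffineVirasoro.d B n})

variable {A}
variable (ψ : A ⊗[ℂ] cartan B H →ₗ[ℂ] ℂ)

/-- The left ideal of `U(𝔏(A))` generated by `𝔏(A)⁺` and by the `h - ψ h` with `h` in
`𝔏(A)⁰`. -/
def vermaIdeal : Submodule (UniversalEnvelopingAlgebra ℂ (LoopAlgebra A B))
    (UniversalEnvelopingAlgebra ℂ (LoopAlgebra A B)) :=
  Submodule.span _
    ({u | ∃ a : A, ∃ X ∈ positivePart B b,
        u = UniversalEnvelopingAlgebra.ι ℂ (LoopAlgebra.elt B a X)} ∪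
      {u | ∃ h : A ⊗[ℂ] cartan B H,
        u = UniversalEnvelopingAlgebra.ι ℂ (cartanIncl A B H h) - algebraMap ℂ _ (ψ h)})

/-- The Verma module `M(ψ)`, the `𝔏(A)`-module induced from the one-dimensional module of
`𝔏(A)⁺ ⊕ 𝔏(A)⁰` on which `𝔏(A)⁺` acts by zero and `𝔏(A)⁰` acts through `ψ`. It is the
quotient of `U(𝔏(A))` by the left ideal generated by the annihilator of that module. -/
def Verma : Type _ :=
  UniversalEnvelopingAlgebra ℂ (LoopAlgebra A B) ⧸ vermaIdeal B b ψ

namespace Verma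

instance : AddCommGroup (Verma B b ψ) :=
  inferInstanceAs (AddCommGroup (UniversalEnvelopingAlgebra ℂ (LoopAlgebra A B) ⧸ vermaIdeal B b ψ))

instance : Module (UniversalEnvelopingAlgebra ℂ (LoopAlgebra A B)) (Verma B b ψ) :=
  inferInstanceAs (Module (UniversalEnvelopingAlgebra ℂ (LoopAlgebra A B))
    (UniversalEnvelopingAlgebra ℂ (LoopAlgebra A B) ⧸ vermaIdeal B b ψ))

instance : Module ℂ (Verma B b ψ) :=
  inferInstanceAs (Module ℂ
    (UniversalEnvelopingAlgebra ℂ (LoopAlgebra A B) ⧸ vermaIdeal B b ψ))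

instance : IsScalarTower ℂ (UniversalEnvelopingAlgebra ℂ (LoopAlgebra A B)) (Verma B b ψ) :=
  inferInstanceAs (IsScalarTower ℂ (UniversalEnvelopingAlgebra ℂ (LoopAlgebra A B))
    (UniversalEnvelopingAlgebra ℂ (LoopAlgebra A B) ⧸ vermaIdeal B b ψ))

attribute [local instance 100] LieRing.ofAssociativeRing

/-- `𝔏(A)` acts on `M(ψ)` through its image in `U(𝔏(A))`. -/
instance : LieRingModule (LoopAlgebra A B) (Verma B b ψ) where
  bracket X m := UniversalEnvelopingAlgebra.ι ℂ X • m
  add_lie X Y m := by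
    rw [map_add, add_smul]
  lie_add X m m' := smul_add _ m m'
  leibniz_lie X Y m := by
    rw [LieHom.map_lie, LieRing.of_associative_ring_bracket, sub_smul, mul_smul, mul_smul,
      sub_add_cancel]

lemma lie_def (X : LoopAlgebra A B) (m : Verma B b ψ) :
    ⁅X, m⁆ = UniversalEnvelopingAlgebra.ι ℂ X • m := rfl

instance : LieModule ℂ (LoopAlgebra A B) (Verma B b ψ) where
  smul_lie t X m := by rw [lie_def, lie_def, map_smul, smul_assoc]
  lie_smul t X m := by rw [lie_def, lie_def, smul_algebra_smul_comm]

end Verma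

end Loop

end LoopAffineVirasoro

end

open scoped TensorProduct

noncomputable section

namespace LoopAffineVirasoro

/-! ### A nilpotency criterion for current algebras of rank one -/

section Current

variable {A V : Type*} [CommRing A] [AddCommGroup V] [Module ℂ V]

/-! Let `v` be the image of the generator of the Verma module. If `X` in 𝔏 is a weight vector of
non-zero weight, then `a ↦ (X ⊗ a) v` maps `A` to a single weight space, which is
finite-dimensional. Its kernel is an ideal: bracketing with `h ⊗ a`, which acts on `v` by a scalar,
multiplies the `A`-component by `a`. So `X ⊗ a` kills `v` for all `a` in an ideal of finite
codimension (`exists_ideal_lie_eq_zero`). Only finitely many `X` are needed: one in each root space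
of 𝔤, one of the form `y ⊗ t⁻¹`, and `d (-1)`, `d (-2)`. Let `I` be the intersection of their
ideals.

Applying an opposite raising operator to `(X ⊗ a) v = 0` shows that `ψ` vanishes at `[X⁺, X] ⊗ a`
for `a ∈ I`. The two Virasoro pairs give `d 0` and `C`.

For root vectors, local nilpotency improves `I` to its radical. Put `E = x ⊗ 1`, `F a = y ⊗ a`, `H a
= [x, y] ⊗ a` and let `c a` be the eigenvalue of `H a` on `v`. If `c` vanishes on the multiples of
`x ^ 2`, then `E ^ N (F x) ^ N v = N! (c x) ^ N v`, so nilpotency of `F x` on `v` forces `c x = 0`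
(`eigenvalue_eq_zero_of_sq`). Descending along the powers of `a ∈ √I` gives `c a = 0`. Simple root
vectors yield the coroots, which span 𝔥; a pair `x ⊗ t`, `y ⊗ t⁻¹` with `⟨x, y⟩ ≠ 0` then yields
`K`. -/

/-- The span of the vectors `F z₁ ⋯ F zₙ v` with all `zᵢ` in `J`. -/
def productSpan (F : A → Module.End ℂ V) (v : V) (J : Ideal A) : ℕ → Submodule ℂ V
  | 0 => Submodule.span ℂ {v}
  | n + 1 => ⨆ z : J, (productSpan F v J n).map (F z)

/-- The span of the vectors `F z₁ ⋯ F zₙ v` with all `zᵢ` in `J` and at least one `zᵢ` in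
`J ^ 2`. -/
def productSpanSq (F : A → Module.End ℂ V) (v : V) (J : Ideal A) : ℕ → Submodule ℂ V
  | 0 => ⊥
  | n + 1 => (⨆ z : J, (productSpanSq F v J n).map (F z)) ⊔
      ⨆ w : (J ^ 2 : Ideal A), (productSpan F v J n).map (F w)

variable {F H : A → Module.End ℂ V} {E : Module.End ℂ V} {κ : ℂ} {c : A → ℂ} {v : V} {J : Ideal A}

lemma map_mem_productSpan {z : A} (hz : z ∈ J) {n : ℕ} {p : V} (hp : p ∈ productSpan F v J n) :
    F z p ∈ productSpan F v J (n + 1) :=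
  Submodule.mem_iSup_of_mem (⟨z, hz⟩ : J) (Submodule.mem_map_of_mem hp)

lemma map_mem_productSpanSq {z : A} (hz : z ∈ J) {n : ℕ} {p : V}
    (hp : p ∈ productSpanSq F v J n) : F z p ∈ productSpanSq F v J (n + 1) :=
  Submodule.mem_sup_left (Submodule.mem_iSup_of_mem (⟨z, hz⟩ : J) (Submodule.mem_map_of_mem hp))

lemma map_mem_productSpanSq_of_mem_sq {w : A} (hw : w ∈ J ^ 2) {n : ℕ} {p : V}
    (hp : p ∈ productSpan F v J n) : F w p ∈ productSpanSq F v J (n + 1) :=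
  Submodule.mem_sup_right (Submodule.mem_iSup_of_mem (⟨w, hw⟩ : (J ^ 2 : Ideal A))
    (Submodule.mem_map_of_mem hp))

lemma productSpan_succ_le {n : ℕ} {S : Submodule ℂ V}
    (h : ∀ z ∈ J, ∀ p ∈ productSpan F v J n, F z p ∈ S) : productSpan F v J (n + 1) ≤ S :=
  iSup_le fun z ↦ Submodule.map_le_iff_le_comap.mpr fun p hp ↦ h z z.2 p hp

lemma productSpanSq_succ_le {n : ℕ} {S : Submodule ℂ V}
    (h : ∀ z ∈ J, ∀ p ∈ productSpanSq F v J n, F z p ∈ S)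
    (h' : ∀ w ∈ J ^ 2, ∀ p ∈ productSpan F v J n, F w p ∈ S) :
    productSpanSq F v J (n + 1) ≤ S :=
  sup_le (iSup_le fun z ↦ Submodule.map_le_iff_le_comap.mpr fun p hp ↦ h z z.2 p hp)
    (iSup_le fun w ↦ Submodule.map_le_iff_le_comap.mpr fun p hp ↦ h' w w.2 p hp)

lemma productSpanSq_le_productSpan (n : ℕ) : productSpanSq F v J n ≤ productSpan F v J n := by
  induction n with
  | zero => exact bot_le
  | succ n ih =>
    exact productSpanSq_succ_le (fun z hz p hp ↦ map_mem_productSpan hz (ih hp))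
      fun w hw p hp ↦ map_mem_productSpan (Ideal.pow_le_self two_ne_zero hw) hp

/-- Moving `H y` to the right past a letter `F z` costs `κ F (y z)`, and `y z` lies in `J ^ 2`.
Modulo words with a letter in `J ^ 2`, only the eigenvalue on `v` survives. -/
lemma cartan_sub_smul_mem_productSpanSq
    (hHF : ∀ y z u, H y (F z u) = F z (H y u) + κ • F (y * z) u) (hH : ∀ y, H y v = c y • v)
    (n : ℕ) {y : A} (hy : y ∈ J) :
    ∀ p ∈ productSpan F v J n, H y p - c y • p ∈ productSpanSq F v J n := by
  change productSpan F v J n ≤ (productSpanSq F v J n).comap (H y - c y • LinearMap.id)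
  induction n with
  | zero => simp [productSpan, Submodule.span_le, productSpanSq, hH]
  | succ n ih =>
    refine productSpan_succ_le fun z hz p hp ↦ ?_
    have h1 := map_mem_productSpanSq hz (ih hp)
    have h2 := map_mem_productSpanSq_of_mem_sq (F := F) (w := y * z)
      (by rw [sq]; exact Ideal.mul_mem_mul hy hz) hp
    simpa [hHF, add_sub_right_comm] using add_mem h1 (Submodule.smul_mem _ κ h2)

lemma cartan_mem_productSpan
    (hHF : ∀ y z u, H y (F z u) = F z (H y u) + κ • F (y * z) u) (hH : ∀ y, H y v = c y • v)
    {n : ℕ} {y : A} (hy : y ∈ J) {p : V} (hp : p ∈ productSpan F v J n) :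
    H y p ∈ productSpan F v J n := by
  rw [← sub_add_cancel (H y p) (c y • p)]
  exact add_mem (productSpanSq_le_productSpan n
    (cartan_sub_smul_mem_productSpanSq hHF hH n hy p hp)) (Submodule.smul_mem _ _ hp)

lemma cartan_mem_productSpanSq
    (hHF : ∀ y z u, H y (F z u) = F z (H y u) + κ • F (y * z) u) (hH : ∀ y, H y v = c y • v)
    (n : ℕ) {y : A} (hy : y ∈ J) :
    ∀ p ∈ productSpanSq F v J n, H y p ∈ productSpanSq F v J n := by
  change productSpanSq F v J n ≤ (productSpanSq F v J n).comap (H y)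
  induction n with
  | zero => exact bot_le
  | succ n ih =>
    refine productSpanSq_succ_le (fun z hz p hp ↦ ?_) fun w hw p hp ↦ ?_
    · rw [Submodule.mem_comap, hHF]
      exact add_mem (map_mem_productSpanSq hz (ih hp)) (Submodule.smul_mem _ _
        (map_mem_productSpanSq (J.mul_mem_right _ hy) hp))
    · rw [Submodule.mem_comap, hHF]
      exact add_mem (map_mem_productSpanSq_of_mem_sq hw (cartan_mem_productSpan hHF hH hy hp))
        (Submodule.smul_mem _ _ (map_mem_productSpanSq_of_mem_sq (Ideal.mul_mem_left _ _ hw) hp))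

lemma raise_mem_productSpan (hEF : ∀ z u, E (F z u) = F z (E u) + H z u)
    (hHF : ∀ y z u, H y (F z u) = F z (H y u) + κ • F (y * z) u) (hH : ∀ y, H y v = c y • v)
    (hE : E v = 0) (n : ℕ) :
    ∀ p ∈ productSpan F v J (n + 1), E p ∈ productSpan F v J n := by
  change productSpan F v J (n + 1) ≤ (productSpan F v J n).comap E
  induction n with
  | zero =>
    refine productSpan_succ_le fun z hz p hp ↦ ?_
    obtain ⟨r, rfl⟩ := Submodule.mem_span_singleton.mp hp
    simpa [hEF, hE] using Submodule.smul_mem _ r (cartan_mem_productSpan hHF hH hz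
      (Submodule.mem_span_singleton_self v))
  | succ n ih =>
    refine productSpan_succ_le fun z hz p hp ↦ ?_
    rw [Submodule.mem_comap, hEF]
    exact add_mem (map_mem_productSpan hz (ih hp)) (cartan_mem_productSpan hHF hH hz hp)

/-- Commuting `E` towards `v` turns one letter `F z` into `H z`. If a letter in `J ^ 2` is left
over, the word stays in the span. If the letter in `J ^ 2` is itself consumed, it becomes `H w`,
which acts as `c w = 0` modulo the span: this is where `hc` enters. -/
lemma raise_mem_productSpanSq (hEF : ∀ z u, E (F z u) = F z (E u) + H z u)
    (hHF : ∀ y z u, H y (F z u) = F z (H y u) + κ • F (y * z) u) (hH : ∀ y, H y v = c y • v)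
    (hE : E v = 0) (hc : ∀ w ∈ J ^ 2, c w = 0) (n : ℕ) :
    ∀ p ∈ productSpanSq F v J (n + 1), E p ∈ productSpanSq F v J n := by
  change productSpanSq F v J (n + 1) ≤ (productSpanSq F v J n).comap E
  have key {n : ℕ} {w : A} (hw : w ∈ J ^ 2) {p : V} (hp : p ∈ productSpan F v J n) :
      H w p ∈ productSpanSq F v J n := by
    simpa [hc w hw] using
      cartan_sub_smul_mem_productSpanSq hHF hH n (Ideal.pow_le_self two_ne_zero hw) p hp
  induction n with
  | zero =>
    refine productSpanSq_succ_le (fun z hz p hp ↦ ?_) fun w hw p hp ↦ ?_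
    · obtain rfl : p = 0 := hp
      simp
    · obtain ⟨r, rfl⟩ := Submodule.mem_span_singleton.mp hp
      rw [Submodule.mem_comap, hEF, map_smul, hE, smul_zero, map_zero, zero_add]
      exact key hw hp
  | succ n ih =>
    refine productSpanSq_succ_le (fun z hz p hp ↦ ?_) fun w hw p hp ↦ ?_
    · rw [Submodule.mem_comap, hEF]
      exact add_mem (map_mem_productSpanSq hz (ih hp)) (cartan_mem_productSpanSq hHF hH _ hz _ hp)
    · rw [Submodule.mem_comap, hEF]
      exact add_mem (map_mem_productSpanSq_of_mem_sq hw (raise_mem_productSpan hEF hHF hH hE n p hp))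
        (key hw hp)

lemma pow_mem_productSpan {x : A} (hx : x ∈ J) (n : ℕ) : (F x ^ n) v ∈ productSpan F v J n := by
  induction n with
  | zero => exact Submodule.mem_span_singleton_self v
  | succ n ih => rw [pow_succ', Module.End.mul_apply]; exact map_mem_productSpan hx ih

/-- Each of the `n + 1` letters `F x`, when replaced by `H x`, contributes `c x` modulo words with a
letter in `J ^ 2`. -/
lemma raise_pow_sub_mem (hEF : ∀ z u, E (F z u) = F z (E u) + H z u)
    (hHF : ∀ y z u, H y (F z u) = F z (H y u) + κ • F (y * z) u) (hH : ∀ y, H y v = c y • v)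
    (hE : E v = 0) {x : A} (hx : x ∈ J) (n : ℕ) :
    E ((F x ^ (n + 1)) v) - ((n + 1 : ℂ) * c x) • (F x ^ n) v ∈ productSpanSq F v J n := by
  induction n with
  | zero => simp [hEF, hE, hH, productSpanSq]
  | succ n ih =>
    have h1 := map_mem_productSpanSq hx ih
    have h2 := cartan_sub_smul_mem_productSpanSq hHF hH (n + 1) hx _ (pow_mem_productSpan hx _)
    convert add_mem h1 h2 using 1
    rw [pow_succ' _ (n + 1), Module.End.mul_apply, hEF, map_sub, map_smul, ← Module.End.mul_apply
      (F x) (F x ^ n), ← pow_succ']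
    push_cast
    module

/-- If `E` kills `v` and `F x` is nilpotent on `v`, then the eigenvalue `c x` of `H x` vanishes as
soon as `c` vanishes on the multiples of `x ^ 2`. -/
lemma eigenvalue_eq_zero_of_sq (hEF : ∀ z u, E (F z u) = F z (E u) + H z u)
    (hHF : ∀ y z u, H y (F z u) = F z (H y u) + κ • F (y * z) u) (hH : ∀ y, H y v = c y • v)
    (hE : E v = 0) (hv : v ≠ 0) {x : A} (hc : ∀ z, c (x ^ 2 * z) = 0) {N : ℕ}
    (hN : (F x ^ N) v = 0) : c x = 0 := by
  -- For a principal `J`, the elements of `J ^ 2` are exactly the multiples of `x ^ 2`, on which `c`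
  -- vanishes.
  set J := Ideal.span {x} with hJ
  have hx : x ∈ J := Ideal.mem_span_singleton_self x
  have hc' (w) (hw : w ∈ J ^ 2) : c w = 0 := by
    rw [hJ, Ideal.span_singleton_pow] at hw
    obtain ⟨z, rfl⟩ := Ideal.mem_span_singleton.mp hw
    exact hc z
  -- Each `E` shortens the words by one letter, and the span at length `0` is zero. The error terms
  -- are therefore killed and the formula `hP` is exact.
  have hQ (n : ℕ) (q) (hq : q ∈ productSpanSq F v J n) : (E ^ n) q = 0 := by
    induction n generalizing q with
    | zero => exact hq
    | succ n ih =>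
      rw [pow_succ, Module.End.mul_apply]
      exact ih _ (raise_mem_productSpanSq hEF hHF hH hE hc' n q hq)
  have hP (n : ℕ) : (E ^ n) ((F x ^ n) v) = ((n.factorial : ℂ) * c x ^ n) • v := by
    induction n with
    | zero => simp
    | succ n ih =>
      have h := hQ n _ (raise_pow_sub_mem hEF hHF hH hE hx n)
      rw [map_sub, sub_eq_zero, map_smul, ih] at h
      rw [pow_succ E, Module.End.mul_apply, h, smul_smul, Nat.factorial_succ]
      push_cast
      ring_nf
  have h := hP N
  rw [hN, map_zero, eq_comm, smul_eq_zero, or_iff_left hv, mul_eq_zero,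
    or_iff_right (Nat.cast_ne_zero.mpr N.factorial_ne_zero)] at h
  exact eq_zero_of_pow_eq_zero h

lemma eigenvalue_eq_zero_of_mem_radical (hEF : ∀ z u, E (F z u) = F z (E u) + H z u)
    (hHF : ∀ y z u, H y (F z u) = F z (H y u) + κ • F (y * z) u) (hH : ∀ y, H y v = c y • v)
    (hE : E v = 0) (hv : v ≠ 0) (hN : ∀ x, ∃ N : ℕ, (F x ^ N) v = 0) {I : Ideal A}
    (hI : ∀ a ∈ I, c a = 0) {a : A} (ha : a ∈ I.radical) : c a = 0 := by
  obtain ⟨m, hm⟩ := ha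
  -- The square of `a ^ (k + 1) z` has exponent `2 k + 2 ≥ k + 2`. The shift by one matters: the
  -- descent stops at `a ^ 1`, as the square of a multiple of `a ^ 0` need not be divisible by `a`.
  have key (k : ℕ) (h : ∀ z, c (a ^ (k + 2) * z) = 0) (z : A) : c (a ^ (k + 1) * z) = 0 := by
    obtain ⟨N, hN⟩ := hN (a ^ (k + 1) * z)
    refine eigenvalue_eq_zero_of_sq hEF hHF hH hE hv (fun y ↦ ?_) hN
    rw [show (a ^ (k + 1) * z) ^ 2 * y = a ^ (k + 2) * (a ^ k * z ^ 2 * y) by ring]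
    exact h _
  have descend (k : ℕ) : (∀ z, c (a ^ (k + 1) * z) = 0) → ∀ z, c (a ^ (0 + 1) * z) = 0 := by
    induction k with
    | zero => exact id
    | succ k ih => exact fun h ↦ ih (key k h)
  have := descend m (fun z ↦ hI _ (I.mul_mem_right _ (by rw [pow_succ]; exact I.mul_mem_right _ hm))) 1
  simpa using this

end Current

/-! ### Highest weight vectors -/

/-- The quotient embeds in the finite product of the `A ⧸ I i`. -/
lemma finite_quotient_iInf {A ι : Type*} [CommRing A] [Algebra ℂ A] [Finite ι] (I : ι → Ideal A)
    (hI : ∀ i, Module.Finite ℂ (A ⧸ I i)) : Module.Finite ℂ (A ⧸ ⨅ i, I i) :=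
  Module.Finite.of_injective
    ({ Ideal.quotientInfToPiQuotient I with
        map_smul' := fun r x ↦ by
          obtain ⟨x, rfl⟩ := Ideal.Quotient.mk_surjective x
          rfl } : (A ⧸ ⨅ i, I i) →ₗ[ℂ] ∀ i, A ⧸ I i)
    (Ideal.quotientInfToPiQuotient_inj I)

section HighestWeight

variable {𝔤 : Type*} [LieRing 𝔤] [LieAlgebra ℂ 𝔤] {B : InvariantForm 𝔤}
variable {A : Type*} [CommRing A] [Algebra ℂ A]

lemma LoopAlgebra.elt_add (a a' : A) (X : AffineVirasoro B) :
    LoopAlgebra.elt B (a + a') X = LoopAlgebra.elt B a X + LoopAlgebra.elt B a' X := by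
  rw [LoopAlgebra.elt, TensorProduct.add_tmul, map_add]; rfl

lemma LoopAlgebra.elt_smul (r : ℂ) (a : A) (X : AffineVirasoro B) :
    LoopAlgebra.elt B (r • a) X = r • LoopAlgebra.elt B a X := by
  rw [LoopAlgebra.elt, ← TensorProduct.smul_tmul', map_smul]; rfl

lemma LoopAlgebra.elt_smul_right (r : ℂ) (a : A) (X : AffineVirasoro B) :
    LoopAlgebra.elt B a (r • X) = r • LoopAlgebra.elt B a X := by
  rw [LoopAlgebra.elt, TensorProduct.tmul_smul, map_smul]; rfl

/-- The span of an element is stable under the Cartan subalgebra as soon as it is stable under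
`𝔥` and `d 0`. -/
lemma exists_weight {H : LieSubalgebra ℂ 𝔤} {X : AffineVirasoro B}
    (hH : ∀ h : H, ∃ r : ℂ, ⁅AffineVirasoro.elt B 0 (h : 𝔤), X⁆ = r • X)
    (hd : ∃ r : ℂ, ⁅AffineVirasoro.d B 0, X⁆ = r • X) :
    ∃ wt : Module.Dual ℂ (cartan B H), ∀ h : cartan B H, ⁅(h : AffineVirasoro B), X⁆ = wt h • X := by
  let φ : AffineVirasoro B →ₗ[ℂ] AffineVirasoro B :=
    { toFun := fun Y ↦ ⁅Y, X⁆
      map_add' := fun Y Z ↦ add_lie Y Z X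
      map_smul' := fun r Y ↦ smul_lie r Y X }
  have key : cartan B H ≤ (Submodule.span ℂ {X}).comap φ := by
    refine sup_le (Submodule.map_le_iff_le_comap.mpr fun h hh ↦ ?_) (Submodule.span_le.mpr ?_)
    · obtain ⟨r, hr⟩ := hH ⟨h, hh⟩
      exact Submodule.mem_span_singleton.mpr ⟨r, hr.symm⟩
    · rintro _ (rfl | rfl | rfl)
      · exact Submodule.mem_span_singleton.mpr
          ⟨0, by rw [zero_smul]; exact (AffineVirasoro.lie_K B X).symm⟩
      · obtain ⟨r, hr⟩ := hd
        exact Submodule.mem_span_singleton.mpr ⟨r, hr.symm⟩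
      · exact Submodule.mem_span_singleton.mpr
          ⟨0, by rw [zero_smul]; exact (AffineVirasoro.lie_C B X).symm⟩
  -- For `X ≠ 0` the weight is the coordinate of `[h, X]` on the line spanned by `X`; for `X = 0`
  -- any functional will do.
  by_cases hX : X = 0
  · exact ⟨0, fun h ↦ by rw [hX, lie_zero, smul_zero]⟩
  · let φ' : cartan B H →ₗ[ℂ] Submodule.span ℂ {X} := φ.restrict key
    refine ⟨(LinearEquiv.toSpanNonzeroSingleton ℂ _ X hX).symm ∘ₗ φ', fun h ↦ ?_⟩
    exact (congrArg Subtype.val ((LinearEquiv.toSpanNonzeroSingleton ℂ _ X hX).apply_symm_apply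
      (φ' h))).symm

variable [FiniteDimensional ℂ 𝔤] [LieAlgebra.IsKilling ℂ 𝔤]
  {H : LieSubalgebra ℂ 𝔤} [H.IsCartanSubalgebra]
variable (b : (LieAlgebra.IsKilling.rootSystem H).Base) (ψ : A ⊗[ℂ] cartan B H →ₗ[ℂ] ℂ)
variable {V : Type*} [AddCommGroup V] [Module ℂ V] [LieRingModule (LoopAlgebra A B) V]

/-- A highest weight vector of weight `ψ`. -/
structure IsHighestWeightVector (v : V) : Prop where
  ne_zero : v ≠ 0
  lie_positivePart : ∀ (a : A), ∀ X ∈ positivePart B b, ⁅LoopAlgebra.elt B a X, v⁆ = 0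
  lie_cartan : ∀ (a : A) (h : cartan B H),
    ⁅LoopAlgebra.elt B a (h : AffineVirasoro B), v⁆ = ψ (a ⊗ₜ[ℂ] h) • v

namespace IsHighestWeightVector

variable {b ψ} {v : V}

/-- Apply `X ⊗ 1`, which kills `v`, to `(Y ⊗ a) v = 0`. -/
lemma eigenvalue_eq_zero (hv : IsHighestWeightVector b ψ v) {X Y : AffineVirasoro B}
    {h : cartan B H} (hX : X ∈ positivePart B b)
    (hXY : ⁅X, Y⁆ = h) {a : A} (ha : ⁅LoopAlgebra.elt B a Y, v⁆ = 0) : ψ (a ⊗ₜ[ℂ] h) = 0 := by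
  have := leibniz_lie (LoopAlgebra.elt B (1 : A) X) (LoopAlgebra.elt B a Y) v
  rw [ha, lie_zero, hv.lie_positivePart 1 X hX, lie_zero, add_zero, LoopAlgebra.lie_elt_elt, hXY,
    hv.lie_cartan, one_mul, eq_comm, smul_eq_zero] at this
  exact this.resolve_right hv.ne_zero

variable [LieModule ℂ (LoopAlgebra A B) V]

/-- Weights only see `h ⊗ 1`, so the weight does not depend on `a`: one weight space receives all of
`A`. -/
lemma lie_mem_weightSpace (hv : IsHighestWeightVector b ψ v) {X : AffineVirasoro B}
    {wt : Module.Dual ℂ (cartan B H)}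
    (hwt : ∀ h : cartan B H, ⁅(h : AffineVirasoro B), X⁆ = wt h • X) (a : A) :
    ⁅LoopAlgebra.elt B a X, v⁆ ∈
      weightSpace A B H V (ψ ∘ₗ TensorProduct.mk ℂ A (cartan B H) 1 + wt) := by
  rw [mem_weightSpace]
  intro h
  rw [leibniz_lie, LoopAlgebra.lie_elt_elt, hv.lie_cartan, lie_smul, one_mul, hwt,
    LoopAlgebra.elt_smul_right, smul_lie, ← add_smul, add_comm (wt h)]
  rfl

/-- If the weight spaces are finite-dimensional, then a weight vector `X` of non-zero weight
satisfies `(X ⊗ I) v = 0` for an ideal `I` of finite codimension. -/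
lemma exists_ideal_lie_eq_zero (hv : IsHighestWeightVector b ψ v)
    (hfin : ∀ wt : Module.Dual ℂ (cartan B H), Module.Finite ℂ (weightSpace A B H V wt))
    {X : AffineVirasoro B} (hH : ∀ h : H, ∃ r : ℂ, ⁅AffineVirasoro.elt B 0 (h : 𝔤), X⁆ = r • X)
    (hd : ∃ r : ℂ, ⁅AffineVirasoro.d B 0, X⁆ = r • X)
    (hne : ∃ h : cartan B H, ∃ r : ℂ, r ≠ 0 ∧ ⁅(h : AffineVirasoro B), X⁆ = r • X) :
    ∃ I : Ideal A, Module.Finite ℂ (A ⧸ I) ∧ ∀ a ∈ I, ⁅LoopAlgebra.elt B a X, v⁆ = 0 := by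
  obtain ⟨wt, hwt⟩ := exists_weight hH hd
  obtain ⟨h, r, hr, hX⟩ := hne
  let φ : A →ₗ[ℂ] weightSpace A B H V (ψ ∘ₗ TensorProduct.mk ℂ A (cartan B H) 1 + wt) :=
    { toFun := fun a ↦ ⟨⁅LoopAlgebra.elt B a X, v⁆, hv.lie_mem_weightSpace hwt a⟩
      map_add' := fun a a' ↦ Subtype.ext (by
        simp only [LoopAlgebra.elt_add, add_lie]; rfl)
      map_smul' := fun r a ↦ Subtype.ext (by
        simp only [LoopAlgebra.elt_smul, smul_lie]; rfl) }
  have hφ (a : A) : φ a = 0 ↔ ⁅LoopAlgebra.elt B a X, v⁆ = 0 := Subtype.ext_iff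
  let I : Ideal A :=
    { carrier := {a | φ a = 0}
      add_mem' := fun ha ha' ↦ (φ.ker).add_mem ha ha'
      zero_mem' := map_zero φ
      -- Bracketing `X ⊗ a'` with `h ⊗ a` gives `r X ⊗ a a'`. Both orders of the product kill `v`,
      -- since `h ⊗ a` acts on `v` by a scalar, and `r ≠ 0` can be cancelled.
      smul_mem' := fun a a' ha ↦ by
        rw [Set.mem_ofPred_eq, hφ] at ha ⊢
        have := leibniz_lie (LoopAlgebra.elt B a (h : AffineVirasoro B)) (LoopAlgebra.elt B a' X) v
        rw [ha, lie_zero, hv.lie_cartan, lie_smul, ha, smul_zero, add_zero, LoopAlgebra.lie_elt_elt,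
          hX, LoopAlgebra.elt_smul_right, smul_lie, eq_comm, smul_eq_zero] at this
        exact this.resolve_left hr }
  have := hfin (ψ ∘ₗ TensorProduct.mk ℂ A (cartan B H) 1 + wt)
  have hI : I.restrictScalars ℂ ≤ φ.ker := fun a ha ↦ ha
  have hI' : φ.ker ≤ I.restrictScalars ℂ := fun a ha ↦ ha
  have : Module.Finite ℂ (A ⧸ I.restrictScalars ℂ) :=
    Module.Finite.of_injective ((I.restrictScalars ℂ).liftQ φ hI)
      (LinearMap.ker_eq_bot.mp (Submodule.ker_liftQ_eq_bot _ _ _ hI'))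
  exact ⟨I, Module.Finite.equiv (Submodule.Quotient.restrictScalarsEquiv ℂ I),
    fun a ha ↦ (hφ a).mp ha⟩

/-- The rank-one criterion for `E = X ⊗ 1`, `F a = Y ⊗ a`, `H a = h ⊗ a`. The scalar `κ` is
arbitrary, so no normalisation as an `sl₂`-triple is required and `h` may have a component along
`K`. -/
lemma eigenvalue_eq_zero_of_mem_radical (hv : IsHighestWeightVector b ψ v)
    {X Y : AffineVirasoro B} {h : cartan B H}
    (hX : X ∈ positivePart B b) (hXY : ⁅X, Y⁆ = h) {κ : ℂ} (hY : ⁅(h : AffineVirasoro B), Y⁆ = κ • Y)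
    (hN : ∀ a : A, ∃ N : ℕ,
      (LieModule.toEnd ℂ (LoopAlgebra A B) V (LoopAlgebra.elt B a Y) ^ N) v = 0)
    {I : Ideal A} (hI : ∀ a ∈ I, ⁅LoopAlgebra.elt B a Y, v⁆ = 0) {a : A} (ha : a ∈ I.radical) :
    ψ (a ⊗ₜ[ℂ] h) = 0 := by
  refine LoopAffineVirasoro.eigenvalue_eq_zero_of_mem_radical (κ := κ)
    (F := fun a ↦ LieModule.toEnd ℂ (LoopAlgebra A B) V (LoopAlgebra.elt B a Y))
    (H := fun a ↦ LieModule.toEnd ℂ (LoopAlgebra A B) V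
      (LoopAlgebra.elt B a (h : AffineVirasoro B)))
    (E := LieModule.toEnd ℂ (LoopAlgebra A B) V (LoopAlgebra.elt B 1 X))
    (c := fun a ↦ ψ (a ⊗ₜ[ℂ] h)) (fun z u ↦ ?_) (fun y z u ↦ ?_) (fun y ↦ hv.lie_cartan y h)
    (hv.lie_positivePart 1 X hX) hv.ne_zero hN (fun a ha ↦ hv.eigenvalue_eq_zero hX hXY (hI a ha)) ha
  · simp only [LieModule.toEnd_apply_apply]
    rw [leibniz_lie, LoopAlgebra.lie_elt_elt, hXY, one_mul, add_comm]
  · simp only [LieModule.toEnd_apply_apply]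
    rw [leibniz_lie, LoopAlgebra.lie_elt_elt, hY, LoopAlgebra.elt_smul_right, smul_lie, add_comm]

end IsHighestWeightVector

end HighestWeight

/-! ### The generator of the Verma module as a highest weight vector -/

section Verma

variable {𝔤 : Type*} [LieRing 𝔤] [LieAlgebra ℂ 𝔤] {B : InvariantForm 𝔤}
variable {A : Type*} [CommRing A] [Algebra ℂ A]
variable [FiniteDimensional ℂ 𝔤] [LieAlgebra.IsKilling ℂ 𝔤]
  {H : LieSubalgebra ℂ 𝔤} [H.IsCartanSubalgebra]
variable (b : (LieAlgebra.IsKilling.rootSystem H).Base) (ψ : A ⊗[ℂ] cartan B H →ₗ[ℂ] ℂ)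

attribute [local instance 100] LieRing.ofAssociativeRing

/-- The universal enveloping algebra is generated by the Lie algebra. -/
lemma universalEnvelopingAlgebra_induction {L : Type*} [LieRing L] [LieAlgebra ℂ L]
    (S : Subalgebra ℂ (UniversalEnvelopingAlgebra ℂ L))
    (hS : ∀ x, UniversalEnvelopingAlgebra.ι ℂ x ∈ S) (u : UniversalEnvelopingAlgebra ℂ L) :
    u ∈ S := by
  let f : L →ₗ⁅ℂ⁆ S :=
    { toFun := fun x ↦ ⟨UniversalEnvelopingAlgebra.ι ℂ x, hS x⟩
      map_add' := fun x y ↦ Subtype.ext (map_add _ x y)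
      map_smul' := fun r x ↦ Subtype.ext (map_smul _ r x)
      map_lie' := fun {x y} ↦ Subtype.ext (LieHom.map_lie _ x y) }
  -- Both algebra maps restrict to `ι` on `L`, so the universal property identifies them.
  have h : S.val.comp (UniversalEnvelopingAlgebra.lift ℂ f) = AlgHom.id ℂ _ := by
    ext x
    simp only [LieHom.comp_apply, AlgHom.coe_toLieHom, AlgHom.comp_apply,
      AlgHom.id_apply]
    exact congrArg Subtype.val (UniversalEnvelopingAlgebra.lift_ι_apply ℂ f x)
  rw [← AlgHom.id_apply (R := ℂ) u, ← h]
  exact (UniversalEnvelopingAlgebra.lift ℂ f u).2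

/-- A Lie submodule of the Verma module is stable under the universal enveloping algebra. -/
lemma Verma.smul_mem (M' : LieSubmodule ℂ (LoopAlgebra A B) (Verma B b ψ))
    (u : UniversalEnvelopingAlgebra ℂ (LoopAlgebra A B)) {m : Verma B b ψ} (hm : m ∈ M') :
    u • m ∈ M' := by
  let S : Subalgebra ℂ (UniversalEnvelopingAlgebra ℂ (LoopAlgebra A B)) :=
    { carrier := {u | ∀ m ∈ M', u • m ∈ M'}
      mul_mem' := fun {u w} hu hw m hm ↦ by rw [mul_smul]; exact hu _ (hw m hm)
      add_mem' := fun {u w} hu hw m hm ↦ by rw [add_smul]; exact add_mem (hu m hm) (hw m hm)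
      algebraMap_mem' := fun r m hm ↦ by
        rw [algebraMap_smul]; exact M'.smul_mem r hm }
  exact universalEnvelopingAlgebra_induction S (fun x m hm ↦ M'.lie_mem (x := x) hm) u m hm

/-- The generator of the Verma module. -/
def Verma.generator : Verma B b ψ := (vermaIdeal B b ψ).mkQ 1

lemma Verma.smul_generator (u : UniversalEnvelopingAlgebra ℂ (LoopAlgebra A B)) :
    u • generator b ψ = (vermaIdeal B b ψ).mkQ u := by
  change u • (vermaIdeal B b ψ).mkQ 1 = _
  rw [← map_smul, smul_eq_mul, mul_one]

lemma Verma.smul_generator_eq_zero {u : UniversalEnvelopingAlgebra ℂ (LoopAlgebra A B)}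
    (hu : u ∈ vermaIdeal B b ψ) : u • generator b ψ = 0 := by
  rw [smul_generator]
  exact (Submodule.Quotient.mk_eq_zero _).mpr hu

lemma isHighestWeightVector_quotient {M' : LieSubmodule ℂ (LoopAlgebra A B) (Verma B b ψ)}
    (hM' : M' ≠ ⊤) :
    IsHighestWeightVector b ψ (LieSubmodule.Quotient.mk' M' (Verma.generator b ψ)) where
  -- The generator is cyclic: were it in `M'`, then `M'` would be everything.
  ne_zero h := by
    refine hM' (eq_top_iff.mpr fun m _ ↦ ?_)
    obtain ⟨u, rfl⟩ := (vermaIdeal B b ψ).mkQ_surjective m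
    have hg : Verma.generator b ψ ∈ M' := (LieSubmodule.Quotient.mk_eq_zero' ).mp h
    rw [← Verma.smul_generator]
    exact Verma.smul_mem b ψ M' u hg
  lie_positivePart a X hX := by
    rw [← LieModuleHom.map_lie, Verma.lie_def, Verma.smul_generator_eq_zero, map_zero]
    exact Submodule.subset_span (Or.inl ⟨a, X, hX, rfl⟩)
  lie_cartan a h := by
    have h' := Verma.smul_generator_eq_zero b ψ (Submodule.subset_span (Or.inr ⟨a ⊗ₜ[ℂ] h, rfl⟩))
    rw [sub_smul, sub_eq_zero, algebraMap_smul] at h'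
    rw [← LieModuleHom.map_lie, Verma.lie_def, ← map_smul, ← h']
    rfl

end Verma

/-! ### Brackets with `𝔥 ⊗ 1` and `d 0` -/

section Bracket

variable {𝔤 : Type*} [LieRing 𝔤] [LieAlgebra ℂ 𝔤] {B : InvariantForm 𝔤}

lemma AffineVirasoro.lie_elt_zero_elt (x y : 𝔤) (n : ℤ) :
    ⁅AffineVirasoro.elt B 0 x, AffineVirasoro.elt B n y⁆ = AffineVirasoro.elt B n ⁅x, y⁆ := by
  rw [AffineVirasoro.lie_elt_elt, zero_add, neg_zero]
  split_ifs with h <;> simp [h]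

lemma AffineVirasoro.lie_d_zero_elt (x : 𝔤) (n : ℤ) :
    ⁅AffineVirasoro.d B 0, AffineVirasoro.elt B n x⁆ = (n : ℂ) • AffineVirasoro.elt B n x := by
  rw [AffineVirasoro.lie_d_elt, add_zero]

lemma AffineVirasoro.lie_d_zero_d (n : ℤ) :
    ⁅AffineVirasoro.d B 0, AffineVirasoro.d B n⁆ = (n : ℂ) • AffineVirasoro.d B n := by
  rw [AffineVirasoro.lie_d_d]
  simp

lemma AffineVirasoro.lie_elt_zero_d (x : 𝔤) (n : ℤ) :
    ⁅AffineVirasoro.elt B 0 x, AffineVirasoro.d B n⁆ = 0 := by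
  rw [← lie_skew, AffineVirasoro.lie_d_elt]
  simp

end Bracket

open LieAlgebra LieAlgebra.IsKilling

/-! ### Pairing of root spaces under the invariant form -/

section InvariantForm

variable {𝔤 : Type*} [LieRing 𝔤] [LieAlgebra ℂ 𝔤] [FiniteDimensional ℂ 𝔤] [IsKilling ℂ 𝔤]
  {H : LieSubalgebra ℂ 𝔤} [H.IsCartanSubalgebra]

lemma InvariantForm.add_eq_zero_of_ne_zero (B : InvariantForm 𝔤) {α β : H → ℂ} {x y : 𝔤}
    (hx : x ∈ rootSpace H α) (hy : y ∈ rootSpace H β) (h : B.form x y ≠ 0) : β = -α := by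
  ext t
  have := B.invariant t x y
  rw [← LieSubalgebra.coe_bracket_of_module, ← LieSubalgebra.coe_bracket_of_module,
    lie_eq_smul_of_mem_rootSpace hx, lie_eq_smul_of_mem_rootSpace hy, map_smul, map_smul,
    LinearMap.smul_apply, smul_eq_mul, smul_eq_mul, ← neg_mul] at this
  have := mul_right_cancel₀ h this
  simp [this]

/-- By invariance the root space of `α` pairs to zero with every root space except that of `-α`, so
non-degeneracy must be witnessed there. -/
lemma InvariantForm.exists_ne_zero (B : InvariantForm 𝔤) {α : H → ℂ} {x : 𝔤}
    (hx : x ∈ rootSpace H α) (hx0 : x ≠ 0) : ∃ y ∈ rootSpace H (-α), B.form x y ≠ 0 := by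
  by_contra! hB
  refine hx0 (B.nondegenerate.1 x fun y ↦ ?_)
  have hy : y ∈ ⨆ β : H → ℂ, rootSpace H β := by
    simp [LieModule.iSup_genWeightSpace_eq_top]
  induction hy using LieSubmodule.iSup_induction' with
  | mem β y hy =>
    by_contra h
    exact h (hB y (B.add_eq_zero_of_ne_zero hx hy h ▸ hy))
  | zero => simp
  | add y z _ _ hy hz => rw [map_add, hy, hz, add_zero]

end InvariantForm

/-! ### Vanishing of `ψ` on `d 0`, `C`, the coroots and `K` -/

section Main

variable {𝔤 : Type*} [LieRing 𝔤] [LieAlgebra ℂ 𝔤] [FiniteDimensional ℂ 𝔤] [IsKilling ℂ 𝔤]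
  {H : LieSubalgebra ℂ 𝔤} [H.IsCartanSubalgebra] {B : InvariantForm 𝔤}
variable {A : Type*} [CommRing A] [Algebra ℂ A]
variable {b : (rootSystem H).Base} {ψ : A ⊗[ℂ] cartan B H →ₗ[ℂ] ℂ}
variable {V : Type*} [AddCommGroup V] [Module ℂ V] [LieRingModule (LoopAlgebra A B) V]
  {v : V}

lemma elt_zero_mem_positivePart {α : H.root} (hα : b.IsPos α) {x : 𝔤} (hx : x ∈ rootSpace H α.1) :
    AffineVirasoro.elt B 0 x ∈ positivePart B b :=
  Submodule.subset_span (Or.inl (Or.inl ⟨α, hα, x, hx, rfl⟩))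

lemma elt_mem_positivePart {n : ℤ} (hn : 0 < n) (x : 𝔤) :
    AffineVirasoro.elt B n x ∈ positivePart B b :=
  Submodule.subset_span (Or.inl (Or.inr ⟨n, hn, x, rfl⟩))

lemma d_mem_positivePart {n : ℤ} (hn : 0 < n) : AffineVirasoro.d B n ∈ positivePart B b :=
  Submodule.subset_span (Or.inr ⟨n, hn, rfl⟩)

lemma lie_elt_zero_elt_of_mem_rootSpace {β : H → ℂ} {y : 𝔤} (hy : y ∈ rootSpace H β) (n : ℤ)
    (h : H) : ⁅AffineVirasoro.elt B 0 (h : 𝔤), AffineVirasoro.elt B n y⁆ =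
      β h • AffineVirasoro.elt B n y := by
  rw [AffineVirasoro.lie_elt_zero_elt, ← LieSubalgebra.coe_bracket_of_module,
    lie_eq_smul_of_mem_rootSpace hy, map_smul]

lemma isNonZero_neg_root (α : H.root) : (-α.1).IsNonZero :=
  LieModule.Weight.isNonZero_neg.mpr (Finset.mem_filter.mp α.2).2

namespace IsHighestWeightVector

lemma eigenvalue_d_eq_zero (hv : IsHighestWeightVector b ψ v) {a : A}
    (h : ⁅LoopAlgebra.elt B a (AffineVirasoro.d B (-1)), v⁆ = 0) :
    ψ (a ⊗ₜ[ℂ] cartan.d₀ B H) = 0 := by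
  -- `[d 1, d (-1)] = -2 d 0`; the central term vanishes because `1 ^ 3 - 1 = 0`.
  have := hv.eigenvalue_eq_zero (h := (-2 : ℂ) • cartan.d₀ B H) (d_mem_positivePart one_pos)
    (by rw [AffineVirasoro.lie_d_d, Submodule.coe_smul]; norm_num; rfl) h
  rw [TensorProduct.tmul_smul, map_smul, smul_eq_zero] at this
  exact this.resolve_left (by norm_num)

lemma eigenvalue_C_eq_zero (hv : IsHighestWeightVector b ψ v) {a : A}
    (h : ψ (a ⊗ₜ[ℂ] cartan.d₀ B H) = 0)
    (h' : ⁅LoopAlgebra.elt B a (AffineVirasoro.d B (-2)), v⁆ = 0) :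
    ψ (a ⊗ₜ[ℂ] cartan.C B H) = 0 := by
  -- `[d 2, d (-2)] = -4 d 0 + (2 ^ 3 - 2) / 12 C`; two is the least positive index at which `C`
  -- appears.
  have := hv.eigenvalue_eq_zero
    (h := (-4 : ℂ) • cartan.d₀ B H + (1 / 2 : ℂ) • cartan.C B H) (d_mem_positivePart two_pos)
    (by
      rw [AffineVirasoro.lie_d_d, Submodule.coe_add, Submodule.coe_smul, Submodule.coe_smul]
      norm_num
      rfl) h'
  rw [TensorProduct.tmul_add, TensorProduct.tmul_smul, TensorProduct.tmul_smul, map_add, map_smul,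
    map_smul, h, smul_zero, zero_add, smul_eq_zero] at this
  exact this.resolve_left (by norm_num)

variable [LieModule ℂ (LoopAlgebra A B) V]

lemma exists_ideal_lie_elt_eq_zero (hv : IsHighestWeightVector b ψ v)
    (hfin : ∀ wt : Module.Dual ℂ (cartan B H), Module.Finite ℂ (weightSpace A B H V wt))
    {β : H → ℂ} {y : 𝔤} (hy : y ∈ rootSpace H β) {h : H} (hβ : β h ≠ 0) (n : ℤ) :
    ∃ I : Ideal A, Module.Finite ℂ (A ⧸ I) ∧
      ∀ a ∈ I, ⁅LoopAlgebra.elt B a (AffineVirasoro.elt B n y), v⁆ = 0 :=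
  hv.exists_ideal_lie_eq_zero hfin
    (fun h ↦ ⟨_, lie_elt_zero_elt_of_mem_rootSpace hy n h⟩) ⟨_, AffineVirasoro.lie_d_zero_elt y n⟩
    ⟨cartan.ofFinite B H h, _, hβ, lie_elt_zero_elt_of_mem_rootSpace hy n h⟩

/-- Here `𝔥` acts by zero, and the non-zero eigenvalue `n` comes from `d 0`. -/
lemma exists_ideal_lie_d_eq_zero (hv : IsHighestWeightVector b ψ v)
    (hfin : ∀ wt : Module.Dual ℂ (cartan B H), Module.Finite ℂ (weightSpace A B H V wt))
    {n : ℤ} (hn : n ≠ 0) :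
    ∃ I : Ideal A, Module.Finite ℂ (A ⧸ I) ∧
      ∀ a ∈ I, ⁅LoopAlgebra.elt B a (AffineVirasoro.d B n), v⁆ = 0 :=
  hv.exists_ideal_lie_eq_zero hfin
    (fun h ↦ ⟨0, by rw [AffineVirasoro.lie_elt_zero_d, zero_smul]⟩)
    ⟨_, AffineVirasoro.lie_d_zero_d n⟩
    ⟨cartan.d₀ B H, _, Int.cast_ne_zero.mpr hn, AffineVirasoro.lie_d_zero_d n⟩

lemma eigenvalue_coroot_eq_zero (hv : IsHighestWeightVector b ψ v) (hV : IsIntegrable A B H V)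
    {α : H.root} (hα : b.IsPos α) {x y : 𝔤} (hx : x ∈ rootSpace H α.1)
    (hy : y ∈ rootSpace H (-α.1)) {h : H} (hxy : ⁅x, y⁆ = h) {I : Ideal A}
    (hI : ∀ a ∈ I, ⁅LoopAlgebra.elt B a (AffineVirasoro.elt B 0 y), v⁆ = 0) {a : A}
    (ha : a ∈ I.radical) : ψ (a ⊗ₜ[ℂ] cartan.ofFinite B H h) = 0 := by
  have hh : ⁅(cartan.ofFinite B H h : AffineVirasoro B), AffineVirasoro.elt B 0 y⁆ =
      (-α.1 h) • AffineVirasoro.elt B 0 y :=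
    lie_elt_zero_elt_of_mem_rootSpace hy 0 h
  refine hv.eigenvalue_eq_zero_of_mem_radical (elt_zero_mem_positivePart hα hx) ?_ hh
    (fun a ↦ ?_) hI ha
  · rw [AffineVirasoro.lie_elt_zero_elt, hxy]
    rfl
  · exact hV.locally_nilpotent (-α.1) (isNonZero_neg_root α) 0 y (by simpa using hy) a v

/-- In degrees `1` and `-1` the bracket is `h - ⟨x, y⟩ K`. As `K` is central, `h - ⟨x, y⟩ K` still
acts on `y ⊗ t⁻¹` by `-α h`, so the rank-one criterion applies and `K` is isolated by `hψ`. -/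
lemma eigenvalue_K_eq_zero (hv : IsHighestWeightVector b ψ v) (hV : IsIntegrable A B H V)
    {α : H.root} {x y : 𝔤} (hy : y ∈ rootSpace H (-α.1)) {h : H} (hxy : ⁅x, y⁆ = h)
    (hB : B.form x y ≠ 0) {I : Ideal A}
    (hI : ∀ a ∈ I, ⁅LoopAlgebra.elt B a (AffineVirasoro.elt B (-1) y), v⁆ = 0) {a : A}
    (ha : a ∈ I.radical) (hψ : ψ (a ⊗ₜ[ℂ] cartan.ofFinite B H h) = 0) :
    ψ (a ⊗ₜ[ℂ] cartan.K B H) = 0 := by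
  have hh : ⁅AffineVirasoro.elt B 1 x, AffineVirasoro.elt B (-1) y⁆ =
      ((cartan.ofFinite B H h + (-B.form x y) • cartan.K B H : cartan B H) :
        AffineVirasoro B) := by
    rw [AffineVirasoro.lie_elt_elt, hxy, Submodule.coe_add, Submodule.coe_smul]
    norm_num
    rfl
  have := hv.eigenvalue_eq_zero_of_mem_radical (κ := -α.1 h) (elt_mem_positivePart one_pos x) hh
    (by
      rw [Submodule.coe_add, Submodule.coe_smul, add_lie, smul_lie]
      change ⁅AffineVirasoro.elt B 0 (h : 𝔤), _⁆ + _ • ⁅AffineVirasoro.K B, _⁆ = _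
      rw [AffineVirasoro.lie_K, smul_zero, add_zero]
      exact lie_elt_zero_elt_of_mem_rootSpace hy (-1) h)
    (fun a ↦ hV.locally_nilpotent (-α.1) (isNonZero_neg_root α) (-1) y (by simpa using hy) a v)
    hI ha
  rw [TensorProduct.tmul_add, TensorProduct.tmul_smul, map_add, map_smul, hψ, zero_add,
    smul_eq_zero] at this
  exact this.resolve_left (neg_ne_zero.mpr hB)

end IsHighestWeightVector

/-- The coroots of the base span `H`, so an empty base would force `H = 0`. -/
lemma exists_mem_base_support [Nontrivial H] (b : (rootSystem H).Base) : ∃ α, α ∈ b.support := by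
  by_contra! h
  have hs := b.span_coroot_support
  rw [show (b.support : Set H.root) = ∅ from Set.eq_empty_of_forall_notMem h, Set.image_empty,
    Submodule.span_empty, eq_comm] at hs
  exact bot_ne_top (hs.symm.trans (RootPairing.IsRootSystem.span_coroot_eq_top (P := rootSystem H)))

end Main

end LoopAffineVirasoro

end

/-! ### Intersection of the ideals and conclusion -/

open LoopAffineVirasoro in
theorem mainTheorem4 {𝔤 : Type*} [LieRing 𝔤] [LieAlgebra ℂ 𝔤] [FiniteDimensional ℂ 𝔤]
    [LieAlgebra.IsSimple ℂ 𝔤] (H : LieSubalgebra ℂ 𝔤) [H.IsCartanSubalgebra]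
    (b : (LieAlgebra.IsKilling.rootSystem H).Base) (B : InvariantForm 𝔤)
    {A : Type*} [CommRing A] [Algebra ℂ A] [Algebra.FiniteType ℂ A]
    (ψ : A ⊗[ℂ] cartan B H →ₗ[ℂ] ℂ)
    (M' : LieSubmodule ℂ (LoopAlgebra A B) (Verma B b ψ)) (hM' : IsCoatom M')
    (hV : IsIntegrable A B H (Verma B b ψ ⧸ M')) :
    ∃ I : Ideal A, Module.Finite ℂ (A ⧸ I) ∧
      (∀ a ∈ I, ψ (a ⊗ₜ[ℂ] cartan.d₀ B H) = 0) ∧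
      (∀ a ∈ I, ψ (a ⊗ₜ[ℂ] cartan.C B H) = 0) ∧
      (∀ a ∈ I.radical, ∀ h : H, ψ (a ⊗ₜ[ℂ] cartan.ofFinite B H h) = 0) ∧
      (∀ a ∈ I.radical, ψ (a ⊗ₜ[ℂ] cartan.K B H) = 0) := by
  have hv := isHighestWeightVector_quotient b ψ hM'.1
  have hα (α : H.root) : α.1.IsNonZero := (Finset.mem_filter.mp α.2).2
  choose h e f ht he hf using fun α : H.root ↦
    LieAlgebra.IsKilling.exists_isSl2Triple_of_weight_isNonZero (hα α)
  have hne (α : H.root) : (-α.1 : H → ℂ) (LieAlgebra.IsKilling.coroot α.1) ≠ 0 := by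
    simp [LieAlgebra.IsKilling.root_apply_coroot (hα α)]
  have : Nontrivial 𝔤 := LieAlgebra.IsSimple.nontrivial ℂ 𝔤
  obtain ⟨α₀, hα₀⟩ := exists_mem_base_support b
  -- A single root is enough for `K`; `y` is picked so that its pairing with `e α₀` is non-zero, as
  -- needed to divide by the coefficient of `K`.
  obtain ⟨y, hy, hB⟩ := B.exists_ne_zero (he α₀) (ht α₀).e_ne_zero
  choose I hI hfI using fun α : H.root ↦
    hv.exists_ideal_lie_elt_eq_zero hV.finite_weightSpace (hf α) (hne α) 0
  obtain ⟨IK, hIK, hyK⟩ :=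
    hv.exists_ideal_lie_elt_eq_zero hV.finite_weightSpace hy (hne α₀) (-1)
  obtain ⟨I₁, hI₁, hd₁⟩ := hv.exists_ideal_lie_d_eq_zero hV.finite_weightSpace (n := -1) (by simp)
  obtain ⟨I₂, hI₂, hd₂⟩ := hv.exists_ideal_lie_d_eq_zero hV.finite_weightSpace (n := -2) (by simp)
  let J : H.root ⊕ Fin 3 → Ideal A := Sum.elim I ![IK, I₁, I₂]
  have hJI (α : H.root) : ⨅ i, J i ≤ I α := iInf_le J (Sum.inl α)
  have hJK : ⨅ i, J i ≤ IK := iInf_le J (Sum.inr 0)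
  have hJ₁ : ⨅ i, J i ≤ I₁ := iInf_le J (Sum.inr 1)
  have hJ₂ : ⨅ i, J i ≤ I₂ := iInf_le J (Sum.inr 2)
  have hH : ∀ a ∈ (⨅ i, J i).radical, ∀ t : H, ψ (a ⊗ₜ[ℂ] cartan.ofFinite B H t) = 0 := by
    intro a ha t
    -- Both sides are linear in `t`, so it suffices to treat the simple coroots, which come from
    -- `sl₂`-triples of positive roots.
    have hspan : t ∈ Submodule.span ℂ ((LieAlgebra.IsKilling.rootSystem H).coroot '' b.support) := by
      rw [b.span_coroot_support]
      exact (RootPairing.IsRootSystem.span_coroot_eq_top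
        (P := LieAlgebra.IsKilling.rootSystem H)).ge trivial
    let φ : H →ₗ[ℂ] ℂ :=
      { toFun := fun t ↦ ψ (a ⊗ₜ[ℂ] cartan.ofFinite B H t)
        map_add' := fun s t ↦ by
          rw [← map_add, ← TensorProduct.tmul_add]
          congr 2
          exact Subtype.ext (map_add (AffineVirasoro.elt B 0) (s : 𝔤) t)
        map_smul' := fun r t ↦ by
          rw [RingHom.id_apply, ← map_smul, ← TensorProduct.tmul_smul]
          congr 2
          exact Subtype.ext (map_smul (AffineVirasoro.elt B 0) r (t : 𝔤)) }
    refine (Submodule.span_le (p := φ.ker)).mpr ?_ hspan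
    rintro _ ⟨α, hαb, rfl⟩
    refine hv.eigenvalue_coroot_eq_zero hV (RootPairing.Base.isPos_of_mem_support hαb) (he α) (hf α)
      ?_ (hfI α) (Ideal.radical_mono (hJI α) ha)
    rw [(ht α).lie_e_f, (ht α).h_eq_coroot (hα α) (he α) (hf α)]
    rfl
  refine ⟨⨅ i, J i, finite_quotient_iInf J ?_, fun a ha ↦ hv.eigenvalue_d_eq_zero (hd₁ a (hJ₁ ha)),
    fun a ha ↦ hv.eigenvalue_C_eq_zero (hv.eigenvalue_d_eq_zero (hd₁ a (hJ₁ ha)))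
      (hd₂ a (hJ₂ ha)), hH, fun a ha ↦ ?_⟩
  · rintro (α | i)
    · exact hI α
    · fin_cases i
      · exact hIK
      · exact hI₁
      · exact hI₂
  · have hey : ⁅e α₀, y⁆ ∈ H := by
      rw [LieAlgebra.IsKilling.lie_eq_killingForm_smul_of_mem_rootSpace_of_mem_rootSpace_neg
        (he α₀) hy]
      exact H.smul_mem _ (Subtype.property _)
    exact hv.eigenvalue_K_eq_zero hV hy (h := ⟨_, hey⟩) rfl hB hyK (Ideal.radical_mono hJK ha)
      (hH a ha _)
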